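/- A (purely topological) network system with two distinguished nodes, the source and the target, consists of two thresholds $\alpha,\beta\in\mathbb R$, an energy rule $\mathcal E$ and interaction graphs $C^{(t)}$. It is run on a finite simple graph $G^{(0)}$ with node set $V$, source $s$ and target $d$, as follows. At each time $t=0,1,2,\dots$ every unordered pair $\{u,v\}$ of distinct nodes has an energy $\mathcal E^{(t)}(u,v)\in\mathbb R$, which depends only on $t$, on the current graph $G^{(t)}$ and on $s,d$; the interaction graph $C^{(t)}$ depends on $t,G^{(0)},s,d$. If $\{u,v\}\notin C^{(t)}$, the pair is an edge of $G^{(t+1)}$ if and only if it is an edge of $G^{(t)}$. If $\{u,v\}\in C^{(t)}$, it is a non-edge of $G^{(t+1)}$ when $\mathcal E^{(t)}(u,v)<\alpha$, it keeps its status when $\alpha\le\mathcal E^{(t)}(u,v)<\beta$, and it is an edge of $G^{(t+1)}$ when $\mathcal E^{(t)}(u,v)\ge\beta$. **Theorem.** For all reals $0<\alpha<\beta$ there is a network system with thresholds $\alpha,\beta$, one and the same for all finite graphs, with the following properties. 1. *Alternating interaction graphs.* If $s$ and $d$ are at distance at most $6$ in $G^{(0)}$, then every $C^{(t)}$ consists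 of all pairs except the edges of $G^{(0)}$ that lie on a shortest $s$–$d$ path of $G^{(0)}$. Otherwise $C^{(t)}$ consists of all pairs except the edges of $G^{(0)}$ incident to $d$ when $t$ is even, and of all pairs except the edges of $G^{(0)}$ incident to $s$ when $t$ is odd. 2. *Local, anonymous energy.* There is a constant $r$ such that $\mathcal E^{(t)}(u,v)$ depends only on $t$ and on the isomorphism type of the subgraph of $G^{(t)}$ induced by the nodes at distance at most $r$ from $u$ or from $v$, with $u$, $v$ and (where present) $s$ and $d$ marked. The dependence on $t$ is only through the parity of $t$ and through whether $t=0$. 3. *Local connections.* If $G^{(0)}$ is connected and $s\ne d$, then any two nodes that are adjacent in $G^{(t+1)}$ are at distance at most $15$ in $G^{(t)}$. 4. *It solves single-source single-destination shortest paths.* If $G^{(0)}$ is connected and $s\neq d$, then the process converges to the graph $L$ on $V$ whose edges are exactly the edges of $G^{(0)}$ on shortest $s$–$d$ paths of $G^{(0)}$, together with the edge $\{s,d\}$ (which signals completion). That is, $G^{(t)}=L$ for all sufficiently large $t$, and $G^{(t)}=G^{(t+1)}$ happens only when $G^{(t)}=L$. -/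

import Mathlib

universe u

/-- A (restricted, purely topological) network system on graphs with two distinguished nodes, the
source and the target. It consists of the two thresholds, of an energy rule, which assigns at every
time `n` a real number to every pair of nodes on the basis of the current graph, and of a rule that
produces the interaction graph at time `n` from the initial graph. One system serves all node
sets `V`. The two arguments of type `V` that follow the graph are the source and the target.
Energies are indexed by unordered pairs, so they are symmetric. -/
structure NetworkSystem : Type (u + 1) where
  lower : ℝ
  upper : ℝ
  energy : ∀ {V : Type u}, SimpleGraph V → V → V → ℕ → Sym2 V → ℝ
  interaction : ∀ {V : Type u}, SimpleGraph V → V → V → ℕ → SimpleGraph V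

/-- One round of the threshold process with thresholds `α`, `β`, energy `E` and interaction graph
`C` on the graph `G`. A pair that is not in `C` keeps its status. A pair in `C` becomes a non-edge
if its energy is below `α`, keeps its status if its energy lies in `[α, β)`, and becomes an edge
if its energy is at least `β`. -/
def thresholdStep {V : Type u} (α β : ℝ) (E : Sym2 V → ℝ) (C G : SimpleGraph V) :
    SimpleGraph V where
  Adj u v := u ≠ v ∧
    ((¬ C.Adj u v ∧ G.Adj u v) ∨
      (C.Adj u v ∧ ¬ E s(u, v) < α ∧ (E s(u, v) < β → G.Adj u v)))
  symm := ⟨fun u v h => by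
    rw [Sym2.eq_swap, C.adj_comm, G.adj_comm]
    exact ⟨h.1.symm, h.2⟩⟩
  loopless := ⟨fun _ h => h.1 rfl⟩

/-- The graph formed by all edges of `G` that lie on some shortest path from `s` to `t`. -/
def shortestPathGraph {V : Type u} (G : SimpleGraph V) (s t : V) : SimpleGraph V where
  Adj u v := ∃ p : G.Walk s t, p.length = G.dist s t ∧ s(u, v) ∈ p.edges
  symm := ⟨fun u v ⟨p, hp, h⟩ => ⟨p, hp, by rwa [Sym2.eq_swap]⟩⟩
  loopless := ⟨fun _ ⟨p, _, h⟩ => (p.adj_of_mem_edges h).ne rfl⟩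

/-- The edges of `G` that are incident to the node `z`. -/
def incidentGraph {V : Type u} (G : SimpleGraph V) (z : V) : SimpleGraph V where
  Adj u v := G.Adj u v ∧ (u = z ∨ v = z)
  symm := ⟨fun _ _ h => ⟨h.1.symm, h.2.symm⟩⟩
  loopless := ⟨fun _ h => h.1.ne rfl⟩

/-- The alternating interaction graphs, for the initial graph `G`. If source and target are at
distance at most `6`, all pairs interact except the edges on shortest source-target paths.
Otherwise all pairs interact except the initial edges at the target (at even times) or the initial
edges at the source (at odd times). -/
noncomputable def alternatingInteraction {V : Type u} (G : SimpleGraph V) (s t : V) (n : ℕ) :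
    SimpleGraph V :=
  if G.dist s t ≤ 6 then (shortestPathGraph G s t)ᶜ
  else if Even n then (incidentGraph G t)ᶜ
  else (incidentGraph G s)ᶜ

/-- The nodes at distance at most `r` from `u` or from `v` in `G` (`edist` is infinite between
different components). -/
def view {V : Type u} (G : SimpleGraph V) (r : ℕ) (u v : V) : Set V :=
  {x | G.edist u x ≤ r ∨ G.edist v x ≤ r}

namespace NetworkSystem

/-- The graph at time `n` when the system is started on `G`. -/
def run (N : NetworkSystem.{u}) {V : Type u} (G : SimpleGraph V) (s t : V) : ℕ → SimpleGraph V
  | 0 => G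
  | n + 1 => thresholdStep N.lower N.upper (N.energy (N.run G s t n) s t n)
      (N.interaction G s t n) (N.run G s t n)

/-- The energy rule is local and, apart from the source and the target, nodes are anonymous: for
some constant `r`, the energy of a pair `u, v` is determined by the time and the isomorphism type of
the subgraph induced by the nodes within distance `r` of `u` or of `v`, in which `u`, `v` and, where
present, the source and the target are marked. -/
def HasLocalEnergy (N : NetworkSystem.{u}) : Prop :=
  ∃ r : ℕ, ∀ (n : ℕ) (V W : Type u) [Finite V] [Finite W] (G : SimpleGraph V) (H : SimpleGraph W)
    (s t u v : V) (s' t' u' v' : W)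
    (φ : G.induce (view G r u v) ≃g H.induce (view H r u' v')),
    (∀ x : view G r u v,
      ((x : V) = u ↔ (φ x : W) = u') ∧ ((x : V) = v ↔ (φ x : W) = v') ∧
      ((x : V) = s ↔ (φ x : W) = s') ∧ ((x : V) = t ↔ (φ x : W) = t')) →
    N.energy G s t n s(u, v) = N.energy H s' t' n s(u', v')

/-- The energy rule depends on the time only through the parity and through whether the time
is zero. -/
def HasAlternatingEnergy (N : NetworkSystem.{u}) : Prop :=
  ∀ (V : Type u) (G : SimpleGraph V) (s t : V) (n : ℕ), 1 ≤ n →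
    N.energy G s t (n + 2) = N.energy G s t n

/-- On the initial graph `G`, two nodes get connected only if they were at distance at most `k`
in the previous graph. -/
def ConnectsWithin (N : NetworkSystem.{u}) (k : ℕ) {V : Type u} (G : SimpleGraph V) (s t : V) :
    Prop :=
  ∀ n u v, (N.run G s t (n + 1)).Adj u v → (N.run G s t n).edist u v ≤ k

/-- Started on `G`, the process converges to `L`: it equals `L` from some time on, and it does not
come to a halt (two equal consecutive graphs) at any graph other than `L`. -/
def ConvergesTo (N : NetworkSystem.{u}) {V : Type u} (G : SimpleGraph V) (s t : V)
    (L : SimpleGraph V) : Prop :=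
  (∃ T, ∀ n, T ≤ n → N.run G s t n = L) ∧
    ∀ n, N.run G s t n = N.run G s t (n + 1) → N.run G s t n = L

/-- The system solves the single-source single-destination shortest paths problem: on every
finite connected graph with distinct source and target it converges to the graph of all edges
on shortest paths between them, together with a source-target edge. -/
def SolvesSSSD (N : NetworkSystem.{u}) : Prop :=
  ∀ (V : Type u) [Finite V] (G : SimpleGraph V) (s t : V), G.Connected → s ≠ t →
    N.ConvergesTo G s t (shortestPathGraph G s t ⊔ SimpleGraph.edge s t)

end NetworkSystem

/-! Nodes see only a bounded radius and have no memory, so the diameter must be shrunk without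
losing the shortest paths of $G$; the frozen edges serve as memory. Once the diameter is at most
`sight`, every pair sees the whole graph and can compute shortest paths outright. Write $D$ for the
distance from $s$ to $t$ (the target) in $G$.

If $D\le 6$, the edges on shortest paths are frozen and nothing has to be computed. Both $s$ and $t$
connect to all nodes within distance 3 of either one until both are universal (`collecting_step`);
then every pair except $\{s,t\}$ asks to vanish, and the frozen edges survive. After time 0 this
phase is recognised by $s,t$ being adjacent with equal neighbourhoods (`IsMerged`). The limit is
stable: for $D\ne 2$ it is recognised by `IsSettled`; for $D=2$ the component of $s$ is so small
that the collecting rule adds nothing to it.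

If $D>6$, the target grows until it is adjacent to every node except $s$ (`growing_step`); away from
$t$ the graph is still $G$. At an even time the initial edges at $t$ are frozen and all other edges
at $t$ vanish, so $t$ regains its neighbourhood in $G$. In the same round $s$ must take over keeping
the diameter small: it exchanges its neighbours for all nodes other than $t$ that are not exits
(`detour`). Every exit has a non-exit neighbour, so the diameter is at most 6. Complementing again
gives back the exits, and the lost neighbours of $s$ lie on no shortest path, so the solution can
still be computed (`shortestPathGraph_flipSource`). Cleaning up takes two rounds, since initial
edges at $s$ are frozen at odd times and those at $t$ at even times: the odd round prunes $t$ and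
adds $\{s,t\}$ (`markedDetour`), the even round does the rest. If the growth ends at an odd time,
one round is spent on adding $\{s,t\}$. -/

/-! ### Distances and shortest paths under isomorphisms and in induced subgraphs. -/

namespace SimpleGraph

variable {V W : Type*}

theorem Iso.edist_le {G : SimpleGraph V} {H : SimpleGraph W} (φ : G ≃g H) (a b : V) :
    H.edist (φ a) (φ b) ≤ G.edist a b := by
  by_cases h : G.Reachable a b
  · obtain ⟨p, hp⟩ := h.exists_walk_length_eq_edist
    rw [← hp]
    simpa using H.edist_le (p.map φ.toHom)
  · rw [G.edist_eq_top_of_not_reachable h]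
    exact le_top

theorem Iso.edist_eq {G : SimpleGraph V} {H : SimpleGraph W} (φ : G ≃g H) (a b : V) :
    H.edist (φ a) (φ b) = G.edist a b := by
  refine le_antisymm (φ.edist_le a b) ?_
  simpa using φ.symm.edist_le (φ a) (φ b)

theorem Iso.dist_eq {G : SimpleGraph V} {H : SimpleGraph W} (φ : G ≃g H) (a b : V) :
    H.dist (φ a) (φ b) = G.dist a b := by
  rw [SimpleGraph.dist, SimpleGraph.dist, φ.edist_eq]

/-- A walk of length at most `k` from `a` never leaves the ball of radius `k`, so a view containing
that ball measures such distances correctly. -/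
theorem edist_induce_le_iff {G : SimpleGraph V} {S : Set V} {a b : V} (ha : a ∈ S) (hb : b ∈ S)
    {k : ℕ} (hS : ∀ x, G.edist a x ≤ k → x ∈ S) :
    (G.induce S).edist ⟨a, ha⟩ ⟨b, hb⟩ ≤ k ↔ G.edist a b ≤ k := by
  constructor
  · intro h
    obtain ⟨p, hp⟩ := exists_walk_of_edist_ne_top (ne_top_of_le_ne_top (ENat.natCast_ne_top k) h)
    rw [← hp] at h
    refine le_trans ?_ h
    have := G.edist_le (p.map (Embedding.induce S).toHom)
    rwa [Walk.length_map] at this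
  · intro h
    obtain ⟨p, hp⟩ := exists_walk_of_edist_ne_top (ne_top_of_le_ne_top (ENat.natCast_ne_top k) h)
    rw [← hp] at h
    have hs : ∀ x ∈ p.support, x ∈ S := by
      classical
      intro x hx
      refine hS x ((G.edist_le (p.takeUntil x hx)).trans (le_trans ?_ h))
      exact_mod_cast p.length_takeUntil_le_length hx
    refine le_trans ?_ h
    have := (G.induce S).edist_le (p.induce S hs)
    rwa [show (p.induce S hs).length = p.length by
      rw [← Walk.length_map (Embedding.induce S).toHom (p.induce S hs)]
      exact congrArg Walk.length (Walk.map_induce p hs)] at this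

theorem edist_le_add {G : SimpleGraph V} {a b c : V} {i j : ℕ} (h : G.edist a b ≤ i)
    (h' : G.edist b c ≤ j) : G.edist a c ≤ (i + j : ℕ) := by
  push_cast
  exact G.edist_triangle.trans (add_le_add h h')

theorem Adj.edist_le_one {G : SimpleGraph V} {a b : V} (h : G.Adj a b) :
    G.edist a b ≤ (1 : ℕ) := by
  exact_mod_cast (edist_le_one_iff_adj_or_eq.2 (Or.inl h))

end SimpleGraph

theorem shortestPathGraph_adj_of_iso {V W : Type u} {G : SimpleGraph V} {H : SimpleGraph W}
    (φ : G ≃g H) {s t a b : V} (h : (shortestPathGraph G s t).Adj a b) :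
    (shortestPathGraph H (φ s) (φ t)).Adj (φ a) (φ b) := by
  obtain ⟨p, hp, he⟩ := h
  refine ⟨p.map φ.toHom, by rw [φ.dist_eq, ← hp]; simp, ?_⟩
  rw [SimpleGraph.Walk.edges_map]
  exact List.mem_map.2 ⟨_, he, rfl⟩

theorem shortestPathGraph_iso {V W : Type u} {G : SimpleGraph V} {H : SimpleGraph W}
    (φ : G ≃g H) (s t a b : V) :
    (shortestPathGraph H (φ s) (φ t)).Adj (φ a) (φ b) ↔ (shortestPathGraph G s t).Adj a b := by
  refine ⟨fun h => ?_, shortestPathGraph_adj_of_iso φ⟩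
  simpa using shortestPathGraph_adj_of_iso φ.symm h

/-! ### The phases of the process and the energy rule. -/

/-- The state of the collecting phase for source and target at distance at most `6`. -/
def IsMerged {V : Type u} (H : SimpleGraph V) (s t : V) (n : ℕ) : Prop :=
  (n = 0 ∧ H.edist s t ≤ (6 : ℕ)) ∨
    (n ≠ 0 ∧ H.Adj s t ∧ (∀ x, x ≠ s → x ≠ t → (H.Adj s x ↔ H.Adj t x)) ∧
      ∃ x, H.Adj s x ∧ H.Adj t x)

/-- Source and target are adjacent to all nodes. -/
def BothUniversal {V : Type u} (H : SimpleGraph V) (s t : V) : Prop :=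
  (∀ x, x ≠ s → H.Adj s x) ∧ ∀ x, x ≠ t → H.Adj t x

/-- The target is adjacent to all nodes, with the possible exception of the source. -/
def IsHub {V : Type u} (H : SimpleGraph V) (s t : V) : Prop :=
  ∀ x, x ≠ s → x ≠ t → H.Adj t x

/-- Source and target are adjacent and have no common neighbour. -/
def IsSettled {V : Type u} (H : SimpleGraph V) (s t : V) : Prop :=
  H.Adj s t ∧ ¬ ∃ x, H.Adj s x ∧ H.Adj t x

/-- Every node other than the target is within distance `2` of the source, without passing through
the target. -/
def CoversInTwo {V : Type u} (H : SimpleGraph V) (s t : V) : Prop :=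
  ∀ x, x ≠ s → x ≠ t → H.Adj s x ∨ ∃ y, y ≠ t ∧ H.Adj s y ∧ H.Adj y x

/-- The neighbour `v` of the source has a neighbour, other than the target, outside the closed
neighbourhood of the source. -/
def IsExit {V : Type u} (H : SimpleGraph V) (s t v : V) : Prop :=
  H.Adj s v ∧ ∃ y, y ≠ s ∧ y ≠ t ∧ H.Adj v y ∧ ¬ H.Adj s y

/-- The graph obtained by complementing the neighbourhood of the source and deleting the
source-target edge. -/
def flipSource {V : Type u} (H : SimpleGraph V) (s t : V) : SimpleGraph V where
  Adj u v := u ≠ v ∧ ((u ≠ s ∧ v ≠ s ∧ H.Adj u v) ∨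
    (((u = s ∧ v ≠ t) ∨ (v = s ∧ u ≠ t)) ∧ ¬ H.Adj u v))
  symm := ⟨fun u v h => by
    rw [H.adj_comm v u]
    tauto⟩
  loopless := ⟨fun _ h => h.1 rfl⟩

/-- The target gets connected to all nodes within distance `3` other than the source. -/
def TargetGrows {V : Type u} (H : SimpleGraph V) (s t u v : V) : Prop :=
  H.Adj u v ∨ (u = t ∧ v ≠ s ∧ H.edist t v ≤ (3 : ℕ))

open Classical in
/-- Whether the ordered pair `u, v` asks to be an edge in the next graph. -/
def Wants {V : Type u} (H : SimpleGraph V) (s t : V) (n : ℕ) (u v : V) : Prop :=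
  if IsMerged H s t n then
    if BothUniversal H s t then u = s ∧ v = t
    else H.Adj u v ∨ ((u = s ∨ u = t) ∧ (H.edist s v ≤ (3 : ℕ) ∨ H.edist t v ≤ (3 : ℕ)))
  else if n = 0 then TargetGrows H s t u v
  else if IsSettled H s t then H.Adj u v
  else if CoversInTwo H s t then
    if Even n then (u = s ∧ v = t) ∨ (shortestPathGraph (flipSource H s t) s t).Adj u v
    else (u = s ∧ v = t) ∨
      (H.Adj u v ∧ (u = t ∨ v = t → (shortestPathGraph (flipSource H s t) s t).Adj u v))
  else if IsHub H s t then
    if Even n then (u = s ∧ v ≠ s ∧ v ≠ t ∧ ¬ IsExit H s t v) ∨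
      ((u ≠ s ∧ u ≠ t) ∧ (v ≠ s ∧ v ≠ t) ∧ H.Adj u v)
    else H.Adj u v ∨ (u = s ∧ v = t)
  else TargetGrows H s t u v

/-- `Wants`, evaluated in the subgraph induced by `S`. If the source or the target is out of sight,
the pair behaves as in the phase in which the target grows. -/
def LocallyWants {V : Type u} (G : SimpleGraph V) (S : Set V) (s t : V) (n : ℕ) (u v : V) : Prop :=
  ∃ (hu : u ∈ S) (hv : v ∈ S),
    (∃ (hs : s ∈ S) (ht : t ∈ S), Wants (G.induce S) ⟨s, hs⟩ ⟨t, ht⟩ n ⟨u, hu⟩ ⟨v, hv⟩) ∨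
    ((s ∉ S ∨ t ∉ S) ∧
      (G.Adj u v ∨ (u = t ∧ (G.induce S).edist ⟨u, hu⟩ ⟨v, hv⟩ ≤ (3 : ℕ))))

/-! ### Invariance of the rule under isomorphisms. -/

section Iso

variable {V W : Type u} {G : SimpleGraph V} {H : SimpleGraph W} (φ : G ≃g H) (s t : V)

theorem isMerged_iso (n : ℕ) : IsMerged H (φ s) (φ t) n ↔ IsMerged G s t n := by
  simp only [IsMerged, φ.surjective.forall, φ.surjective.exists, φ.map_adj_iff, φ.edist_eq, ne_eq,
    φ.injective.eq_iff]

theorem bothUniversal_iso : BothUniversal H (φ s) (φ t) ↔ BothUniversal G s t := by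
  simp only [BothUniversal, φ.surjective.forall, φ.map_adj_iff, ne_eq, φ.injective.eq_iff]

theorem isHub_iso : IsHub H (φ s) (φ t) ↔ IsHub G s t := by
  simp only [IsHub, φ.surjective.forall, φ.map_adj_iff, ne_eq, φ.injective.eq_iff]

theorem isSettled_iso : IsSettled H (φ s) (φ t) ↔ IsSettled G s t := by
  simp only [IsSettled, φ.surjective.exists, φ.map_adj_iff]

theorem coversInTwo_iso : CoversInTwo H (φ s) (φ t) ↔ CoversInTwo G s t := by
  simp only [CoversInTwo, φ.surjective.forall, φ.surjective.exists, φ.map_adj_iff, ne_eq,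
    φ.injective.eq_iff]

theorem isExit_iso (v : V) : IsExit H (φ s) (φ t) (φ v) ↔ IsExit G s t v := by
  simp only [IsExit, φ.surjective.exists, φ.map_adj_iff, ne_eq, φ.injective.eq_iff]

/-- Flipping the source commutes with isomorphisms. -/
def flipSourceIso : flipSource G s t ≃g flipSource H (φ s) (φ t) where
  toEquiv := φ.toEquiv
  map_rel_iff' := by
    intro a b
    change (flipSource H (φ s) (φ t)).Adj (φ a) (φ b) ↔ _
    simp only [flipSource, φ.map_adj_iff, ne_eq, φ.injective.eq_iff]

theorem shortestPathGraph_flipSource_iso (a b : V) :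
    (shortestPathGraph (flipSource H (φ s) (φ t)) (φ s) (φ t)).Adj (φ a) (φ b) ↔
      (shortestPathGraph (flipSource G s t) s t).Adj a b :=
  shortestPathGraph_iso (flipSourceIso φ s t) s t a b

theorem wants_iso (n : ℕ) (a b : V) : Wants H (φ s) (φ t) n (φ a) (φ b) ↔ Wants G s t n a b := by
  simp only [Wants, TargetGrows, isExit_iso, shortestPathGraph_flipSource_iso, φ.map_adj_iff,
    φ.edist_eq, ne_eq, φ.injective.eq_iff]
  rw [propext (isMerged_iso φ s t n), propext (bothUniversal_iso φ s t),
    propext (coversInTwo_iso φ s t), propext (isHub_iso φ s t), propext (isSettled_iso φ s t)]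

end Iso

theorem view_comm {V : Type u} (G : SimpleGraph V) (r : ℕ) (u v : V) :
    view G r v u = view G r u v := by
  ext x
  exact or_comm

theorem LocallyWants.of_iso {V W : Type u} {G : SimpleGraph V} {H : SimpleGraph W} {S : Set V}
    {S' : Set W} {s t u v : V} {s' t' u' v' : W} {n : ℕ} (φ : G.induce S ≃g H.induce S')
    (hφ : ∀ x : S, ((x : V) = u ↔ (φ x : W) = u') ∧ ((x : V) = v ↔ (φ x : W) = v') ∧
      ((x : V) = s ↔ (φ x : W) = s') ∧ ((x : V) = t ↔ (φ x : W) = t'))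
    (h : LocallyWants G S s t n u v) : LocallyWants H S' s' t' n u' v' := by
  obtain ⟨hu, hv, h⟩ := h
  have eu : (φ ⟨u, hu⟩ : W) = u' := (hφ ⟨u, hu⟩).1.1 rfl
  have ev : (φ ⟨v, hv⟩ : W) = v' := (hφ ⟨v, hv⟩).2.1.1 rfl
  have key : ∀ (x : S) (y : W) (hy : y ∈ S'), (φ x : W) = y → φ x = ⟨y, hy⟩ :=
    fun x y hy e => Subtype.ext e
  have hu' : u' ∈ S' := eu ▸ (φ ⟨u, hu⟩).2
  have hv' : v' ∈ S' := ev ▸ (φ ⟨v, hv⟩).2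
  refine ⟨hu', hv', ?_⟩
  rcases h with ⟨hs, ht, h⟩ | ⟨hst, h⟩
  · have es : (φ ⟨s, hs⟩ : W) = s' := (hφ ⟨s, hs⟩).2.2.1.1 rfl
    have et : (φ ⟨t, ht⟩ : W) = t' := (hφ ⟨t, ht⟩).2.2.2.1 rfl
    have hs' : s' ∈ S' := es ▸ (φ ⟨s, hs⟩).2
    have ht' : t' ∈ S' := et ▸ (φ ⟨t, ht⟩).2
    refine Or.inl ⟨hs', ht', ?_⟩
    rw [← wants_iso φ, key _ _ hs' es, key _ _ ht' et, key _ _ hu' eu, key _ _ hv' ev] at h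
    exact h
  · refine Or.inr ⟨?_, ?_⟩
    · refine hst.imp (fun hs hs' => hs ?_) (fun ht ht' => ht ?_)
      · have := (hφ (φ.symm ⟨s', hs'⟩)).2.2.1.2 (by simp)
        exact this ▸ (φ.symm ⟨s', hs'⟩).2
      · have := (hφ (φ.symm ⟨t', ht'⟩)).2.2.2.2 (by simp)
        exact this ▸ (φ.symm ⟨t', ht'⟩).2
    · refine h.imp (fun h => ?_) (fun h => ⟨?_, ?_⟩)
      · have : (H.induce S').Adj (φ ⟨u, hu⟩) (φ ⟨v, hv⟩) := φ.map_adj_iff.2 h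
        rw [key _ _ hu' eu, key _ _ hv' ev] at this
        exact this
      · rw [← eu]
        exact (hφ ⟨u, hu⟩).2.2.2.1 h.1
      · have h2 := h.2
        rw [← φ.edist_eq, key _ _ hu' eu, key _ _ hv' ev] at h2
        exact h2

/-! ### The network system, its locality and its dependence on time. -/

/-- The range of sight of the system. -/
def sight : ℕ := 16

open Classical in
/-- The network system that solves the shortest paths problem. -/
noncomputable def sssdSystem (α β : ℝ) : NetworkSystem.{u} where
  lower := α
  upper := β
  energy G s t n e :=
    if ∃ u v, e = s(u, v) ∧ LocallyWants G (view G sight u v) s t n u v then β else 0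
  interaction := alternatingInteraction

/-- The view is symmetric in the two nodes, so both orientations of a pair are judged on the same
set. -/
theorem exists_locallyWants_iff {V : Type u} (G : SimpleGraph V) (s t : V) (n : ℕ) (u v : V) :
    (∃ u' v', s(u, v) = s(u', v') ∧ LocallyWants G (view G sight u' v') s t n u' v') ↔
      LocallyWants G (view G sight u v) s t n u v ∨
        LocallyWants G (view G sight u v) s t n v u := by
  constructor
  · rintro ⟨u', v', e, h⟩
    rcases Sym2.eq_iff.1 e with ⟨rfl, rfl⟩ | ⟨rfl, rfl⟩
    · exact Or.inl h
    · rw [view_comm] at h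
      exact Or.inr h
  · rintro (h | h)
    · exact ⟨u, v, rfl, h⟩
    · rw [← view_comm] at h
      exact ⟨v, u, Sym2.eq_swap, h⟩

theorem sssdSystem_hasLocalEnergy (α β : ℝ) : (sssdSystem.{u} α β).HasLocalEnergy := by
  refine ⟨sight, fun n V W _ _ G H s t u v s' t' u' v' φ hφ => ?_⟩
  simp only [sssdSystem]
  congr 1
  rw [exists_locallyWants_iff, exists_locallyWants_iff]
  have hφ' : ∀ x : view H sight u' v', ((x : W) = u' ↔ (φ.symm x : V) = u) ∧
      ((x : W) = v' ↔ (φ.symm x : V) = v) ∧ ((x : W) = s' ↔ (φ.symm x : V) = s) ∧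
      ((x : W) = t' ↔ (φ.symm x : V) = t) := by
    intro x
    have := hφ (φ.symm x)
    simp only [RelIso.apply_symm_apply] at this
    tauto
  have hs : ∀ x : view G sight u v, ((x : V) = v ↔ (φ x : W) = v') ∧ ((x : V) = u ↔ (φ x : W) = u') ∧
      ((x : V) = s ↔ (φ x : W) = s') ∧ ((x : V) = t ↔ (φ x : W) = t') := by
    intro x
    have := hφ x
    tauto
  have hs' : ∀ x : view H sight u' v', ((x : W) = v' ↔ (φ.symm x : V) = v) ∧
      ((x : W) = u' ↔ (φ.symm x : V) = u) ∧ ((x : W) = s' ↔ (φ.symm x : V) = s) ∧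
      ((x : W) = t' ↔ (φ.symm x : V) = t) := by
    intro x
    have := hφ' x
    tauto
  exact propext (or_congr ⟨.of_iso φ hφ, .of_iso φ.symm hφ'⟩ ⟨.of_iso φ hs, .of_iso φ.symm hs'⟩)

theorem wants_add_two {V : Type u} (H : SimpleGraph V) (s t : V) {n : ℕ} (hn : 1 ≤ n) (u v : V) :
    Wants H s t (n + 2) u v = Wants H s t n u v := by
  have hn' : n ≠ 0 := by omega
  have hm : IsMerged H s t (n + 2) = IsMerged H s t n := by simp [IsMerged, hn']
  have he : Even (n + 2) ↔ Even n := by simp [Nat.even_add]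
  unfold Wants
  rw [hm]
  by_cases h : Even n <;> simp [h, he, hn']

theorem sssdSystem_hasAlternatingEnergy (α β : ℝ) :
    (sssdSystem.{u} α β).HasAlternatingEnergy := by
  intro V G s t n hn
  funext e
  simp only [sssdSystem]
  congr 1
  simp only [LocallyWants, wants_add_two _ _ _ hn]

/-- Adjacency at time `n + 1`, if the system was started on `G` and the graph at time `n` is `H`. -/
def NextAdj {V : Type u} (G H : SimpleGraph V) (s t : V) (n : ℕ) (u v : V) : Prop :=
  ((alternatingInteraction G s t n).Adj u v ∧
      (LocallyWants H (view H sight u v) s t n u v ∨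
        LocallyWants H (view H sight u v) s t n v u)) ∨
    (¬ (alternatingInteraction G s t n).Adj u v ∧ H.Adj u v)

/-- Energies are only `β` or `0 < α`, so the band `[α, β)` is never used; an edge is kept by asking
for it again. -/
theorem run_succ_adj {α β : ℝ} (hα : 0 < α) (hαβ : α < β) {V : Type u} (G : SimpleGraph V)
    (s t : V) (n : ℕ) {u v : V} (huv : u ≠ v) :
    ((sssdSystem α β).run G s t (n + 1)).Adj u v ↔
      NextAdj G ((sssdSystem α β).run G s t n) s t n u v := by
  have hβ : ¬ β < α := by linarith
  simp only [NetworkSystem.run, thresholdStep]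
  simp only [sssdSystem, NextAdj]
  rw [exists_locallyWants_iff]
  split_ifs with h
  · simp [h, huv, hβ]
    tauto
  · simp [h, huv, hα]

open SimpleGraph

/-! ### What a pair decides from its view in each phase. -/

section View

variable {V : Type u} {H : SimpleGraph V} {s t u v : V} {n : ℕ}

theorem mem_view_of_le_left {a x : V} {i j : ℕ} (h : H.edist u a ≤ i) (h' : H.edist a x ≤ j)
    (hij : i + j ≤ sight) : x ∈ view H sight u v :=
  Or.inl ((edist_le_add h h').trans (by exact_mod_cast hij))

theorem mem_view_left : u ∈ view H sight u v := Or.inl (by simp)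

theorem mem_view_right : v ∈ view H sight u v := Or.inr (by simp)

theorem view_eq_univ (h : ∀ x, H.edist u x ≤ sight) : view H sight u v = Set.univ :=
  Set.eq_univ_of_forall fun x => Or.inl (h x)

theorem locallyWants_univ : LocallyWants H Set.univ s t n u v ↔ Wants H s t n u v := by
  have key := wants_iso (induceUnivIso H) ⟨s, trivial⟩ ⟨t, trivial⟩ n ⟨u, trivial⟩ ⟨v, trivial⟩
  constructor
  · rintro ⟨_, _, ⟨_, _, h⟩ | ⟨h | h, _⟩⟩
    · exact key.2 h
    · exact absurd trivial h
    · exact absurd trivial h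
  · exact fun h => ⟨trivial, trivial, Or.inl ⟨trivial, trivial, key.1 h⟩⟩

/-- The next graph, when all nodes see the whole graph. -/
theorem nextAdj_of_forall_edist_le {G : SimpleGraph V} (h : ∀ x y, H.edist x y ≤ sight) :
    NextAdj G H s t n u v ↔
      ((alternatingInteraction G s t n).Adj u v ∧ (Wants H s t n u v ∨ Wants H s t n v u)) ∨
        (¬ (alternatingInteraction G s t n).Adj u v ∧ H.Adj u v) := by
  rw [NextAdj, view_eq_univ (h u), locallyWants_univ, locallyWants_univ]

/-- In a connected graph, the target is adjacent to all nodes but the source as soon as this is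
the case within distance `3`. -/
theorem isHub_of_forall_edist_le (hc : H.Connected)
    (h : ∀ x, x ≠ s → x ≠ t → H.edist t x ≤ (3 : ℕ) → H.Adj t x) : IsHub H s t := by
  -- Along a walk from `t` only `s` can fail to be a neighbour of `t`, and then it is at distance at
  -- most 2. The node after `s` is therefore within 3, which is why the rules use radius 3.
  have key : ∀ x, H.Reachable t x →
      (x = t ∨ H.Adj t x) ∨ (x = s ∧ H.edist t x ≤ (2 : ℕ)) := by
    intro x hx
    rw [reachable_iff_reflTransGen] at hx
    induction hx with
    | refl => exact Or.inl (Or.inl rfl)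
    | @tail x y _ hxy ih =>
      have h1 := hxy.edist_le_one
      by_cases hyt : y = t
      · exact Or.inl (Or.inl hyt)
      by_cases hys : y = s
      · rcases ih with (rfl | ih) | ⟨rfl, ih⟩
        · exact Or.inl (Or.inr hxy)
        · exact Or.inr ⟨hys, edist_le_add ih.edist_le_one h1⟩
        · exact absurd hys hxy.ne'
      · refine Or.inl (Or.inr (h y hys hyt ?_))
        rcases ih with (rfl | ih) | ⟨rfl, ih⟩
        · exact h1.trans (by norm_num)
        · exact (edist_le_add ih.edist_le_one h1).trans (by norm_num)
        · exact edist_le_add ih h1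
  intro x hxs hxt
  rcases key x (hc.preconnected t x) with (h | h) | h
  · exact absurd h hxt
  · exact h
  · exact absurd h.1 hxs

theorem bothUniversal_of_isHub (hst : H.Adj s t) (h : IsHub H s t) (h' : IsHub H t s) :
    BothUniversal H s t := by
  refine ⟨fun x hx => ?_, fun x hx => ?_⟩
  · by_cases e : x = t
    · exact e ▸ hst
    · exact h' x e hx
  · by_cases e : x = s
    · exact e ▸ hst.symm
    · exact h x e hx

/-- No pair ends the collecting phase too early: local universality puts `u` within 1 of `s` and
`t`, so the view contains their balls of radius 3, and `isHub_of_forall_edist_le` makes the property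
global. -/
theorem bothUniversal_of_view (hc : H.Connected) (hst : s ≠ t) (hs : s ∈ view H sight u v)
    (ht : t ∈ view H sight u v)
    (h : BothUniversal (H.induce (view H sight u v)) ⟨s, hs⟩ ⟨t, ht⟩) : BothUniversal H s t := by
  have h1 : ∀ x ∈ view H sight u v, x ≠ s → H.Adj s x := fun x hx hxs =>
    h.1 ⟨x, hx⟩ (fun e => hxs (congrArg Subtype.val e))
  have h2 : ∀ x ∈ view H sight u v, x ≠ t → H.Adj t x := fun x hx hxt =>
    h.2 ⟨x, hx⟩ (fun e => hxt (congrArg Subtype.val e))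
  have hus : H.edist u s ≤ (1 : ℕ) := by
    by_cases e : u = s
    · simp [e]
    · exact (h1 u mem_view_left e).symm.edist_le_one
  have hut : H.edist u t ≤ (1 : ℕ) := by
    by_cases e : u = t
    · simp [e]
    · exact (h2 u mem_view_left e).symm.edist_le_one
  refine bothUniversal_of_isHub (h1 t ht hst.symm) (isHub_of_forall_edist_le hc ?_)
    (isHub_of_forall_edist_le hc ?_)
  · exact fun x _ hxt hx => h2 x (mem_view_of_le_left hut hx (by norm_num [sight])) hxt
  · exact fun x _ hxs hx => h1 x (mem_view_of_le_left hus hx (by norm_num [sight])) hxs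

/-- The wishes in the collecting phase. -/
theorem locallyWants_of_isMerged (hc : H.Connected) (hst : s ≠ t) (hm : IsMerged H s t n)
    (hb : ¬ BothUniversal H s t) :
    LocallyWants H (view H sight u v) s t n u v ↔
      H.Adj u v ∨ ((u = s ∨ u = t) ∧ (H.edist s v ≤ (3 : ℕ) ∨ H.edist t v ≤ (3 : ℕ))) := by
  have hst6 : H.edist s t ≤ (6 : ℕ) := by
    rcases hm with hm | hm
    · exact hm.2
    · exact hm.2.1.edist_le_one.trans (by norm_num)
  set S := view H sight u v with hS
  by_cases hu : u = s ∨ u = t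
  · have hus : H.edist u s ≤ (6 : ℕ) := by
      rcases hu with rfl | rfl
      · simp
      · rwa [edist_comm]
    have hut : H.edist u t ≤ (6 : ℕ) := by
      rcases hu with rfl | rfl
      · assumption
      · simp
    -- Distance 6 between `s` and `t` plus radius 6 for testing it: the sum 12 is the largest demand
    -- made on `sight`.
    have bs : ∀ x, H.edist s x ≤ (6 : ℕ) → x ∈ S := fun x hx =>
      mem_view_of_le_left hus hx (by norm_num [sight])
    have bt : ∀ x, H.edist t x ≤ (6 : ℕ) → x ∈ S := fun x hx =>
      mem_view_of_le_left hut hx (by norm_num [sight])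
    have hs : s ∈ S := bs s (by simp)
    have ht : t ∈ S := bt t (by simp)
    have bs3 : ∀ x, H.edist s x ≤ (3 : ℕ) → x ∈ S := fun x hx => bs x (hx.trans (by norm_num))
    have bt3 : ∀ x, H.edist t x ≤ (3 : ℕ) → x ∈ S := fun x hx => bt x (hx.trans (by norm_num))
    have hm' : IsMerged (H.induce S) ⟨s, hs⟩ ⟨t, ht⟩ n := by
      rcases hm with ⟨h0, h6⟩ | ⟨h0, hadj, hN, x, hx, hx'⟩
      · exact Or.inl ⟨h0, (edist_induce_le_iff hs ht bs).2 h6⟩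
      · refine Or.inr ⟨h0, hadj, fun x hxs hxt => ?_, ⟨x, bs x ?_⟩, hx, hx'⟩
        · exact hN x (fun e => hxs (Subtype.ext e)) (fun e => hxt (Subtype.ext e))
        · exact hx.edist_le_one.trans (by norm_num)
    have hb' : ¬ BothUniversal (H.induce S) ⟨s, hs⟩ ⟨t, ht⟩ := fun h =>
      hb (bothUniversal_of_view hc hst hs ht h)
    have hw : Wants (H.induce S) ⟨s, hs⟩ ⟨t, ht⟩ n ⟨u, mem_view_left⟩ ⟨v, mem_view_right⟩ ↔
        H.Adj u v ∨ ((u = s ∨ u = t) ∧ (H.edist s v ≤ (3 : ℕ) ∨ H.edist t v ≤ (3 : ℕ))) := by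
      rw [Wants, if_pos hm', if_neg hb', edist_induce_le_iff hs mem_view_right bs3,
        edist_induce_le_iff ht mem_view_right bt3, Subtype.mk.injEq, Subtype.mk.injEq]
      rfl
    rw [← hw]
    constructor
    · rintro ⟨_, _, ⟨_, _, h⟩ | ⟨h | h, _⟩⟩
      · exact h
      · exact absurd hs h
      · exact absurd ht h
    · exact fun h => ⟨mem_view_left, mem_view_right, Or.inl ⟨hs, ht, h⟩⟩
  · have hus : u ≠ s := fun e => hu (Or.inl e)
    have hut : u ≠ t := fun e => hu (Or.inr e)
    have hw : ∀ (hs : s ∈ S) (ht : t ∈ S),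
        Wants (H.induce S) ⟨s, hs⟩ ⟨t, ht⟩ n ⟨u, mem_view_left⟩ ⟨v, mem_view_right⟩ ↔
          H.Adj u v := by
      intro hs ht
      have hb' : ¬ BothUniversal (H.induce S) ⟨s, hs⟩ ⟨t, ht⟩ := fun h =>
        hb (bothUniversal_of_view hc hst hs ht h)
      by_cases hm' : IsMerged (H.induce S) ⟨s, hs⟩ ⟨t, ht⟩ n
      · rw [Wants, if_pos hm', if_neg hb']
        simp [hus, hut]
      · rw [Wants, if_neg hm']
        by_cases h0 : n = 0
        · rw [if_pos h0]
          simp [TargetGrows, hut]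
        · rcases hm with ⟨h0', -⟩ | ⟨_, hadj, hN, -⟩
          · exact absurd h0' h0
          -- If no common neighbour of `s` and `t` is in view, the merged graph looks settled; the
          -- wish of this pair is the same.
          have hset : IsSettled (H.induce S) ⟨s, hs⟩ ⟨t, ht⟩ := by
            refine ⟨hadj, fun hx => hm' (Or.inr ⟨h0, hadj, fun x hxs hxt => ?_, hx⟩)⟩
            exact hN x (fun e => hxs (Subtype.ext e)) (fun e => hxt (Subtype.ext e))
          rw [if_neg h0, if_pos hset]
          rfl
    simp only [hu, false_and, or_false]
    constructor
    · rintro ⟨_, _, ⟨hs, ht, h⟩ | ⟨_, h | h⟩⟩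
      · exact (hw hs ht).1 h
      · exact h
      · exact absurd h.1 hut
    · intro h
      refine ⟨mem_view_left, mem_view_right, ?_⟩
      by_cases hs : s ∈ S
      · by_cases ht : t ∈ S
        · exact Or.inl ⟨hs, ht, (hw hs ht).2 h⟩
        · exact Or.inr ⟨Or.inr ht, Or.inl h⟩
      · exact Or.inr ⟨Or.inl hs, Or.inl h⟩

/-- The wishes while the neighbourhood of the target grows. The node `w` is a witness, visible from
the source, that not all nodes are within distance `2` of the source. -/
theorem locallyWants_of_not_isHub (hc : H.Connected) (hst : ¬ H.Adj s t)
    (h0 : n = 0 → ¬ H.edist s t ≤ (6 : ℕ)) (hh : ¬ IsHub H s t) {w : V} (hsw : H.edist s w ≤ (3 : ℕ))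
    (hws : w ≠ s) (hwt : w ≠ t) (hw1 : ¬ H.Adj s w)
    (hw2 : ∀ y, y ≠ t → H.Adj s y → ¬ H.Adj y w) (huv : u ≠ v) :
    LocallyWants H (view H sight u v) s t n u v ↔
      H.Adj u v ∨ (u = t ∧ v ≠ s ∧ H.edist t v ≤ (3 : ℕ)) := by
  obtain ⟨x, hxs, hxt, hx3, hx⟩ :
      ∃ x, x ≠ s ∧ x ≠ t ∧ H.edist t x ≤ (3 : ℕ) ∧ ¬ H.Adj t x := by
    by_contra! hcon
    exact hh (isHub_of_forall_edist_le hc hcon)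
  set S := view H sight u v with hS
  have hgrow : (hut : u = t) → ∀ y, H.edist t y ≤ (3 : ℕ) → y ∈ S := by
    rintro rfl y hy
    exact mem_view_of_le_left (i := 0) (by simp) hy (by norm_num [sight])
  have sym : ∀ {a b : V}, (a = u ∧ b = v) ∨ (a = v ∧ b = u) → view H sight a b = S := by
    rintro a b (⟨rfl, rfl⟩ | ⟨rfl, rfl⟩)
    · rfl
    · exact view_comm ..
  have hcov : ∀ (hs : s ∈ S) (ht : t ∈ S), ¬ CoversInTwo (H.induce S) ⟨s, hs⟩ ⟨t, ht⟩ := by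
    intro hs ht hcov
    -- One of `u`, `v` differs from `t`. Under local covering it is within 2 of `s`, hence sees `w`,
    -- which is not covered.
    have near : ∀ a ∈ S, a ≠ t → H.edist a s ≤ (2 : ℕ) := by
      intro a ha hat
      by_cases has : a = s
      · simp [has]
      rcases hcov ⟨a, ha⟩ (fun e => has (congrArg Subtype.val e))
        (fun e => hat (congrArg Subtype.val e)) with h | ⟨y, -, h, h'⟩
      · exact (SimpleGraph.Adj.edist_le_one (G := H) h.symm).trans (by norm_num)
      · rw [edist_comm]
        exact edist_le_add (SimpleGraph.Adj.edist_le_one (G := H) h)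
          (SimpleGraph.Adj.edist_le_one (G := H) h')
    have hwS : w ∈ S := by
      by_cases hut : u = t
      · rw [← sym (Or.inr ⟨rfl, rfl⟩)]
        exact mem_view_of_le_left (near v mem_view_right (fun e => huv (hut.trans e.symm))) hsw
          (by norm_num [sight])
      · exact mem_view_of_le_left (near u mem_view_left hut) hsw (by norm_num [sight])
    rcases hcov ⟨w, hwS⟩ (fun e => hws (congrArg Subtype.val e))
      (fun e => hwt (congrArg Subtype.val e)) with h | ⟨y, hy, h, h'⟩
    · exact hw1 h
    · exact hw2 y (fun e => hy (Subtype.ext e)) h h'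
  have hhub : ∀ (hs : s ∈ S) (ht : t ∈ S), ¬ IsHub (H.induce S) ⟨s, hs⟩ ⟨t, ht⟩ := by
    intro hs ht hhub
    -- Likewise an endpoint other than `s` would be within 1 of `t` and see the node `x` that `t`
    -- still lacks.
    have near : ∀ a ∈ S, a ≠ s → H.edist a t ≤ (1 : ℕ) := by
      intro a ha has
      by_cases hat : a = t
      · simp [hat]
      exact SimpleGraph.Adj.edist_le_one (G := H) (SimpleGraph.Adj.symm
        (hhub ⟨a, ha⟩ (fun e => has (congrArg Subtype.val e))
          (fun e => hat (congrArg Subtype.val e))))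
    have hxS : x ∈ S := by
      by_cases hus : u = s
      · rw [← sym (Or.inr ⟨rfl, rfl⟩)]
        exact mem_view_of_le_left (near v mem_view_right (fun e => huv (hus.trans e.symm))) hx3
          (by norm_num [sight])
      · exact mem_view_of_le_left (near u mem_view_left hus) hx3 (by norm_num [sight])
    exact hx (hhub ⟨x, hxS⟩ (fun e => hxs (congrArg Subtype.val e))
      (fun e => hxt (congrArg Subtype.val e)))
  have hmer : ∀ (hs : s ∈ S) (ht : t ∈ S), ¬ IsMerged (H.induce S) ⟨s, hs⟩ ⟨t, ht⟩ n := by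
    rintro hs ht (⟨h, h'⟩ | ⟨_, h, _⟩)
    · refine h0 h (le_trans ?_ h')
      obtain ⟨p, hp⟩ := exists_walk_of_edist_ne_top
        (ne_top_of_le_ne_top (ENat.natCast_ne_top 6) h')
      rw [← hp]
      have := H.edist_le (p.map (Embedding.induce S).toHom)
      rwa [Walk.length_map] at this
    · exact hst h
  have hset : ∀ (hs : s ∈ S) (ht : t ∈ S), ¬ IsSettled (H.induce S) ⟨s, hs⟩ ⟨t, ht⟩ :=
    fun _ _ h => hst h.1
  have hw : ∀ (hs : s ∈ S) (ht : t ∈ S),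
      Wants (H.induce S) ⟨s, hs⟩ ⟨t, ht⟩ n ⟨u, mem_view_left⟩ ⟨v, mem_view_right⟩ ↔
        TargetGrows (H.induce S) ⟨s, hs⟩ ⟨t, ht⟩ ⟨u, mem_view_left⟩ ⟨v, mem_view_right⟩ := by
    intro hs ht
    rw [Wants, if_neg (hmer hs ht), if_neg (hset hs ht),
      if_neg (hcov hs ht), if_neg (hhub hs ht), ite_self]
  constructor
  · rintro ⟨_, _, ⟨hs, ht, h⟩ | ⟨h', h | h⟩⟩
    · refine ((hw hs ht).1 h).imp id ?_
      rintro ⟨e, e', h⟩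
      have e : u = t := congrArg Subtype.val e
      exact ⟨e, fun e'' => e' (Subtype.ext e''),
        (edist_induce_le_iff ht mem_view_right (hgrow e)).1 h⟩
    · exact Or.inl h
    -- The rule for hidden source or target need not exclude `v = s`: with `u = t`, both would be
    -- visible.
    · obtain ⟨rfl, h⟩ := h
      refine Or.inr ⟨rfl, ?_, (edist_induce_le_iff _ mem_view_right (hgrow rfl)).1 h⟩
      rintro rfl
      exact h'.elim (· mem_view_right) (· mem_view_left)
  · intro h
    refine ⟨mem_view_left, mem_view_right, ?_⟩
    by_cases hm : s ∈ S ∧ t ∈ S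
    · refine Or.inl ⟨hm.1, hm.2, (hw hm.1 hm.2).2 (h.imp id ?_)⟩
      rintro ⟨rfl, h1, h2⟩
      exact ⟨rfl, fun e => h1 (congrArg Subtype.val e),
        (edist_induce_le_iff _ mem_view_right (hgrow rfl)).2 h2⟩
    · refine Or.inr ⟨not_and_or.1 hm, h.imp id ?_⟩
      rintro ⟨rfl, h1, h2⟩
      exact ⟨rfl, (edist_induce_le_iff _ mem_view_right (hgrow rfl)).2 h2⟩

/-- Graphs in which source and target are adjacent, but have no common neighbour, do not change. -/
theorem locallyWants_of_isSettled (hn : n ≠ 0) (h : IsSettled H s t) :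
    LocallyWants H (view H sight u v) s t n u v ↔ H.Adj u v := by
  set S := view H sight u v with hS
  have hw : ∀ (hs : s ∈ S) (ht : t ∈ S),
      Wants (H.induce S) ⟨s, hs⟩ ⟨t, ht⟩ n ⟨u, mem_view_left⟩ ⟨v, mem_view_right⟩ ↔
        H.Adj u v := by
    intro hs ht
    have hx : ¬ ∃ x, (H.induce S).Adj ⟨s, hs⟩ x ∧ (H.induce S).Adj ⟨t, ht⟩ x :=
      fun ⟨x, h1, h2⟩ => h.2 ⟨x, h1, h2⟩
    have hm : ¬ IsMerged (H.induce S) ⟨s, hs⟩ ⟨t, ht⟩ n := by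
      rintro (h | h)
      · exact hn h.1
      · exact hx h.2.2.2
    rw [Wants, if_neg hm, if_neg hn, if_pos ⟨h.1, hx⟩]
    rfl
  constructor
  · rintro ⟨_, _, ⟨hs, ht, h⟩ | ⟨h', h2 | h2⟩⟩
    · exact (hw hs ht).1 h
    · exact h2
    · obtain ⟨rfl, -⟩ := h2
      have hs : s ∈ S := mem_view_of_le_left (i := 0) (by simp) h.1.symm.edist_le_one
        (by norm_num [sight])
      exact h'.elim (absurd hs) (absurd mem_view_left)
  · intro h2
    refine ⟨mem_view_left, mem_view_right, ?_⟩
    by_cases hm : s ∈ S ∧ t ∈ S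
    · exact Or.inl ⟨hm.1, hm.2, (hw hm.1 hm.2).2 h2⟩
    · exact Or.inr ⟨not_and_or.1 hm, Or.inl h2⟩

end View

/-! ### The shortest path graph and the solution. -/

section ShortestPathGraph

variable {V : Type u} {G H : SimpleGraph V} {s t u v : V} {n : ℕ}

theorem shortestPathGraph_le (G : SimpleGraph V) (s t : V) : shortestPathGraph G s t ≤ G :=
  fun _ _ ⟨p, _, h⟩ => p.adj_of_mem_edges h

theorem SimpleGraph.Walk.dist_add_dist_le_of_mem_darts (hc : G.Connected) {a b : V}
    (p : G.Walk a b) {d : G.Dart} (hd : d ∈ p.darts) :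
    G.dist a d.fst + 1 + G.dist d.snd b ≤ p.length := by
  induction p with
  | nil => simp at hd
  | @cons a c b h p ih =>
    rw [Walk.darts_cons, List.mem_cons] at hd
    rw [Walk.length_cons]
    rcases hd with rfl | hd
    · have := G.dist_le p
      simp only [dist_self]
      omega
    · have h1 := ih hd
      have h2 := hc.dist_triangle (u := a) (v := c) (w := d.fst)
      rw [dist_eq_one_iff_adj.2 h] at h2
      omega

/-- An edge splits a shortest walk into two geodesic pieces; conversely, geodesics to its ends can
be joined through it. -/
theorem shortestPathGraph_adj_iff (hc : G.Connected) :
    (shortestPathGraph G s t).Adj u v ↔ G.Adj u v ∧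
      (G.dist s u + 1 + G.dist v t = G.dist s t ∨ G.dist s v + 1 + G.dist u t = G.dist s t) := by
  have lower : ∀ {a b}, G.Adj a b → G.dist s t ≤ G.dist s a + 1 + G.dist b t := by
    intro a b h
    have h1 := hc.dist_triangle (u := s) (v := a) (w := t)
    have h2 := hc.dist_triangle (u := a) (v := b) (w := t)
    rw [dist_eq_one_iff_adj.2 h] at h2
    omega
  have build : ∀ {a b}, G.Adj a b → G.dist s a + 1 + G.dist b t = G.dist s t →
      (shortestPathGraph G s t).Adj a b := by
    intro a b h e
    obtain ⟨p, hp⟩ := hc.exists_walk_length_eq_dist s a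
    obtain ⟨q, hq⟩ := hc.exists_walk_length_eq_dist b t
    refine ⟨p.append (Walk.cons h q), ?_, ?_⟩
    · rw [Walk.length_append, Walk.length_cons]
      omega
    · simp
  constructor
  · rintro ⟨p, hp, he⟩
    refine ⟨p.adj_of_mem_edges he, ?_⟩
    obtain ⟨⟨⟨a, b⟩, hab⟩, hd, hde⟩ := List.mem_map.1 he
    have h1 : G.dist s a + 1 + G.dist b t ≤ p.length := p.dist_add_dist_le_of_mem_darts hc hd
    have h2 := lower (show G.Adj a b from hab)
    have hde : s(a, b) = s(u, v) := hde
    rcases Sym2.eq_iff.1 hde with ⟨rfl, rfl⟩ | ⟨rfl, rfl⟩ <;> omega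
  · rintro ⟨h, e | e⟩
    · exact build h e
    · exact (build h.symm e).symm

/-- All shortest walks of `G` survive in `H`, so the two distances agree and the shortest walks are
the same. -/
theorem shortestPathGraph_eq_of_le (hr : G.Reachable s t) (h1 : shortestPathGraph G s t ≤ H)
    (h2 : H ≤ G) : shortestPathGraph H s t = shortestPathGraph G s t := by
  have lift : ∀ p : G.Walk s t, p.length = G.dist s t → ∀ e ∈ p.edges, e ∈ H.edgeSet := by
    intro p hp e he
    induction e with
    | h a b => exact h1 ⟨p, hp, he⟩
  have hd : H.dist s t = G.dist s t := by
    obtain ⟨p, hp⟩ := hr.exists_walk_length_eq_dist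
    refine le_antisymm ?_ (Reachable.dist_anti h2 (p.transfer H (lift p hp)).reachable)
    have := H.dist_le (p.transfer H (lift p hp))
    rwa [Walk.length_transfer, hp] at this
  ext a b
  constructor
  · rintro ⟨p, hp, he⟩
    exact ⟨p.mapLe h2, by rw [Walk.length_mapLe, hp, hd], by rwa [Walk.edges_mapLe_eq_edges]⟩
  · rintro ⟨p, hp, he⟩
    exact ⟨p.transfer H (lift p hp), by rw [Walk.length_transfer, hp, hd],
      by rwa [Walk.edges_transfer]⟩

theorem exists_adj_dist_add_one (hc : G.Connected) (h : u ≠ v) :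
    ∃ y, G.Adj u y ∧ G.dist y v + 1 = G.dist u v := by
  obtain ⟨p, hp⟩ := hc.exists_walk_length_eq_dist u v
  cases p with
  | nil => exact absurd rfl h
  | @cons _ y _ hy q =>
    refine ⟨y, hy, ?_⟩
    rw [Walk.length_cons] at hp
    have h1 := G.dist_le q
    have h2 := hc.dist_triangle (u := u) (v := y) (w := v)
    rw [dist_eq_one_iff_adj.2 hy] at h2
    omega

/-- The solution of the shortest paths problem: all edges on shortest paths, and an edge from the
source to the target. -/
abbrev solution (G : SimpleGraph V) (s t : V) : SimpleGraph V :=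
  shortestPathGraph G s t ⊔ edge s t

theorem solution_adj (hst : s ≠ t) : (solution G s t).Adj u v ↔
    (shortestPathGraph G s t).Adj u v ∨ (u = s ∧ v = t) ∨ (u = t ∧ v = s) := by
  rw [sup_adj, edge_adj]
  refine or_congr Iff.rfl ⟨fun h => h.1, fun h => ⟨h, ?_⟩⟩
  rcases h with ⟨rfl, rfl⟩ | ⟨rfl, rfl⟩
  · exact hst
  · exact hst.symm

theorem dist_of_solution_adj_target (hc : G.Connected) (hst : s ≠ t) (hv : v ≠ t)
    (h : (solution G s t).Adj s v) : (shortestPathGraph G s t).Adj s v ∧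
      G.dist v t + 1 = G.dist s t := by
  rcases (solution_adj hst).1 h with h | h | h
  · refine ⟨h, ?_⟩
    have := ((shortestPathGraph_adj_iff hc).1 h).2
    rw [dist_self] at this
    omega
  · exact absurd h.2 hv
  · exact absurd h.1 hst

/-- A common neighbour would be at distance $D-1$ from `t` and adjacent to `t` in `G`, forcing
$D=2$. -/
theorem isSettled_solution (hc : G.Connected) (hst : s ≠ t) (hD : G.dist s t ≠ 2) :
    IsSettled (solution G s t) s t := by
  refine ⟨(solution_adj hst).2 (Or.inr (Or.inl ⟨rfl, rfl⟩)), ?_⟩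
  rintro ⟨x, hs, ht⟩
  have h1 := dist_of_solution_adj_target hc hst ht.ne' hs
  rcases (solution_adj hst).1 ht with h | h | h
  · have := dist_eq_one_iff_adj.2 (shortestPathGraph_le _ _ _ h).symm
    omega
  · exact hst h.1.symm
  · exact hs.ne' h.2

end ShortestPathGraph

/-! ### Distance at most 6: single rounds, and stability of the solution when the distance is 2. -/

section SmallDistance

variable {V : Type u} {G H : SimpleGraph V} {s t u v : V} {n : ℕ}

theorem nextAdj_of_dist_le (hD : G.dist s t ≤ 6) (huv : u ≠ v) :
    NextAdj G H s t n u v ↔ (¬ (shortestPathGraph G s t).Adj u v ∧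
        (LocallyWants H (view H sight u v) s t n u v ∨
          LocallyWants H (view H sight u v) s t n v u)) ∨
      ((shortestPathGraph G s t).Adj u v ∧ H.Adj u v) := by
  rw [NextAdj, alternatingInteraction, if_pos hD, compl_adj]
  simp [huv]

theorem nextAdj_of_isMerged (hD : G.dist s t ≤ 6) (hc : H.Connected) (hst : s ≠ t) (hGH : G ≤ H)
    (hm : IsMerged H s t n) (hb : ¬ BothUniversal H s t) (huv : u ≠ v) :
    NextAdj G H s t n u v ↔ H.Adj u v ∨
      ((u = s ∨ u = t) ∧ (H.edist s v ≤ (3 : ℕ) ∨ H.edist t v ≤ (3 : ℕ))) ∨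
      ((v = s ∨ v = t) ∧ (H.edist s u ≤ (3 : ℕ) ∨ H.edist t u ≤ (3 : ℕ))) := by
  rw [nextAdj_of_dist_le hD huv, locallyWants_of_isMerged hc hst hm hb, ← view_comm,
    locallyWants_of_isMerged hc hst hm hb, H.adj_comm v u]
  have : (shortestPathGraph G s t).Adj u v → H.Adj u v :=
    fun h => hGH (shortestPathGraph_le G s t h)
  tauto

theorem edist_le_of_adj_all {a : V} (h : ∀ x, x ≠ a → H.Adj a x) (x y : V) :
    H.edist x y ≤ (2 : ℕ) := by
  have key : ∀ x, H.edist a x ≤ (1 : ℕ) := by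
    intro x
    by_cases e : x = a
    · simp [e]
    · exact (h x e).edist_le_one
  refine edist_le_add (b := a) (i := 1) (j := 1) ?_ (key y)
  rw [edist_comm]
  exact key x

theorem wants_of_bothUniversal (hm : IsMerged H s t n) (hb : BothUniversal H s t) :
    Wants H s t n u v ↔ u = s ∧ v = t := by
  rw [Wants, if_pos hm, if_pos hb]

theorem nextAdj_of_bothUniversal (hD : G.dist s t ≤ 6) (hst : s ≠ t) (hGH : G ≤ H)
    (hm : IsMerged H s t n) (hb : BothUniversal H s t) (huv : u ≠ v) :
    NextAdj G H s t n u v ↔ (solution G s t).Adj u v := by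
  rw [nextAdj_of_forall_edist_le (fun x y => (edist_le_of_adj_all hb.1 x y).trans
    (by norm_num [sight])), alternatingInteraction, if_pos hD, compl_adj,
    wants_of_bothUniversal hm hb, wants_of_bothUniversal hm hb, solution_adj hst]
  have : (shortestPathGraph G s t).Adj u v → H.Adj u v :=
    fun h => hGH (shortestPathGraph_le G s t h)
  tauto

/-- For $D=2$ every edge on a shortest path joins a midpoint to `s` or `t`, so the component of `s`
contains only `s`, `t` and nodes adjacent to both. -/
theorem solution_adj_of_reachable (hc : G.Connected) (hst : s ≠ t) (hD : G.dist s t = 2)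
    (h : (solution G s t).Reachable s v) :
    v = s ∨ v = t ∨ ((solution G s t).Adj s v ∧ (solution G s t).Adj t v) := by
  have flip : ∀ y, y ≠ t → (solution G s t).Adj s y → (solution G s t).Adj t y := by
    intro y hy h
    have h1 := dist_of_solution_adj_target hc hst hy h
    refine (solution_adj hst).2 (Or.inl ((shortestPathGraph_adj_iff hc).2 ⟨?_, Or.inr ?_⟩))
    · rw [G.adj_comm, ← dist_eq_one_iff_adj]
      omega
    · rw [dist_self, dist_eq_one_iff_adj.2 (shortestPathGraph_le _ _ _ h1.1), hD]
  have flip' : ∀ y, y ≠ s → (solution G s t).Adj t y → (solution G s t).Adj s y := by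
    intro y hy h
    rcases (solution_adj hst).1 h with h | h | h
    · have h1 := (shortestPathGraph_adj_iff hc).1 h
      have h2 : G.dist y t = 1 := dist_eq_one_iff_adj.2 h1.1.symm
      have h3 := h1.2
      rw [dist_self] at h3
      have h4 : G.dist s y = 1 := by omega
      refine (solution_adj hst).2 (Or.inl ((shortestPathGraph_adj_iff hc).2
        ⟨dist_eq_one_iff_adj.1 h4, Or.inl ?_⟩))
      rw [dist_self]
      omega
    · exact absurd h.1 hst.symm
    · exact absurd h.2 hy
  rw [reachable_iff_reflTransGen] at h
  induction h with
  | refl => exact Or.inl rfl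
  | @tail x y _ hxy ih =>
    by_cases hys : y = s
    · exact Or.inl hys
    by_cases hyt : y = t
    · exact Or.inr (Or.inl hyt)
    refine Or.inr (Or.inr ?_)
    rcases ih with rfl | rfl | ⟨h1, h2⟩
    · exact ⟨hxy, flip y hyt hxy⟩
    · exact ⟨flip' y hys hxy, hxy⟩
    · have h1 := dist_of_solution_adj_target hc hst h2.ne' h1
      have h3 : G.dist s x = 1 := dist_eq_one_iff_adj.2 (shortestPathGraph_le _ _ _ h1.1)
      rcases (solution_adj hst).1 hxy with h | h | h
      · have h4 := ((shortestPathGraph_adj_iff hc).1 h).2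
        have h5 := hc.pos_dist_of_ne hyt
        have h6 := hc.pos_dist_of_ne (Ne.symm hys)
        omega
      · exact absurd h.2 hyt
      · exact absurd h.2 hys

theorem isMerged_or_isSettled_induce_solution (hc : G.Connected) (hst : s ≠ t)
    (hD : G.dist s t = 2) (hn : n ≠ 0) {S : Set V} (hs : s ∈ S) (ht : t ∈ S) :
    IsMerged ((solution G s t).induce S) ⟨s, hs⟩ ⟨t, ht⟩ n ∨
      (¬ IsMerged ((solution G s t).induce S) ⟨s, hs⟩ ⟨t, ht⟩ n ∧
        IsSettled ((solution G s t).induce S) ⟨s, hs⟩ ⟨t, ht⟩) := by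
  have hadj : (solution G s t).Adj s t := (solution_adj hst).2 (Or.inr (Or.inl ⟨rfl, rfl⟩))
  have hX := fun y => solution_adj_of_reachable (v := y) hc hst hD
  generalize solution G s t = L at *
  have hM : ∀ x : S, x ≠ ⟨s, hs⟩ → x ≠ ⟨t, ht⟩ →
      ((L.induce S).Adj ⟨s, hs⟩ x ↔ (L.induce S).Adj ⟨t, ht⟩ x) := by
    rintro ⟨x, hx⟩ hxs hxt
    have key : L.Reachable s x → L.Adj s x ∧ L.Adj t x := fun h =>
      ((hX x h).resolve_left fun e => hxs (Subtype.ext e)).resolve_left fun e =>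
        hxt (Subtype.ext e)
    constructor
    · exact fun h => (key (SimpleGraph.Adj.reachable (G := L) h)).2
    · exact fun h => (key (hadj.reachable.trans (SimpleGraph.Adj.reachable (G := L) h))).1
  by_cases hcom : ∃ x, (L.induce S).Adj ⟨s, hs⟩ x ∧ (L.induce S).Adj ⟨t, ht⟩ x
  · exact Or.inl (Or.inr ⟨hn, hadj, hM, hcom⟩)
  · refine Or.inr ⟨?_, hadj, hcom⟩
    rintro (h | h)
    · exact hn h.1
    · exact hcom h.2.2.2

/-- For $D=2$ the solution may look merged and restart the collecting rule; but `s` and `t` only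
reach nodes of their component, to which they are already joined. -/
theorem solution_adj_of_locallyWants (hc : G.Connected) (hst : s ≠ t) (hD : G.dist s t = 2)
    (hn : n ≠ 0) (huv : u ≠ v)
    (h : LocallyWants (solution G s t) (view (solution G s t) sight u v) s t n u v) :
    (solution G s t).Adj u v := by
  have hadj : (solution G s t).Adj s t := (solution_adj hst).2 (Or.inr (Or.inl ⟨rfl, rfl⟩))
  have hX := fun y => solution_adj_of_reachable (v := y) hc hst hD
  obtain ⟨hu, hv, ⟨hs, ht, h⟩ | ⟨h', h | h⟩⟩ := h
  · have hm := isMerged_or_isSettled_induce_solution hc hst hD hn hs ht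
    generalize solution G s t = L at *
    rcases hm with hm | ⟨hm, hset⟩
    · rw [Wants, if_pos hm] at h
      split_ifs at h with hb
      · obtain ⟨e, e'⟩ := h
        obtain rfl : u = s := congrArg Subtype.val e
        obtain rfl : v = t := congrArg Subtype.val e'
        exact hadj
      · rcases h with h | ⟨hu, hv⟩
        · exact h
        · have hr : L.Reachable s v := by
            have key : ∀ a b : view L sight u v, (L.induce _).edist a b ≤ (3 : ℕ) →
                L.Reachable a b :=
              fun a b h => (reachable_of_edist_ne_top
                (ne_top_of_le_ne_top (ENat.natCast_ne_top 3) h)).map (Embedding.induce _).toHom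
            rcases hv with hv | hv
            · exact key _ _ hv
            · exact hadj.reachable.trans (key _ _ hv)
          rcases hu with hu | hu
          · obtain rfl : u = s := congrArg Subtype.val hu
            rcases hX v hr with rfl | rfl | h
            · exact absurd rfl huv
            · exact hadj
            · exact h.1
          · obtain rfl : u = t := congrArg Subtype.val hu
            rcases hX v hr with rfl | rfl | h
            · exact hadj.symm
            · exact absurd rfl huv
            · exact h.2
    · rw [Wants, if_neg hm, if_neg hn, if_pos hset] at h
      exact h
  · exact h
  · obtain ⟨rfl, -⟩ := h
    have hs : s ∈ view (solution G s u) sight u v :=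
      mem_view_of_le_left (i := 0) (by simp) hadj.symm.edist_le_one (by norm_num [sight])
    exact h'.elim (absurd hs) (absurd mem_view_left)

/-- The signalling edge is the only edge of the solution that is not frozen, so it must renew
itself. -/
theorem locallyWants_solution_source_target (hc : G.Connected) (hst : s ≠ t)
    (hD : G.dist s t = 2) (hn : n ≠ 0) :
    LocallyWants (solution G s t) (view (solution G s t) sight s t) s t n s t := by
  have hadj : (solution G s t).Adj s t := (solution_adj hst).2 (Or.inr (Or.inl ⟨rfl, rfl⟩))
  refine ⟨mem_view_left, mem_view_right, Or.inl ⟨mem_view_left, mem_view_right, ?_⟩⟩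
  rcases isMerged_or_isSettled_induce_solution hc hst hD hn mem_view_left mem_view_right with
    hm | ⟨hm, hset⟩
  · rw [Wants, if_pos hm]
    split_ifs
    · exact ⟨rfl, rfl⟩
    · exact Or.inl hadj
  · rw [Wants, if_neg hm, if_neg hn, if_pos hset]
    exact hadj

end SmallDistance

/-- Termination of the collecting and of the growing phase: graphs on a finite node set cannot
increase strictly forever. -/
theorem exists_of_forall_lt_or {A : Type*} [Preorder A] [WellFoundedGT A] (f : ℕ → A)
    (P Q : ℕ → Prop) (h0 : P 0) (h : ∀ n, P n → ¬ Q n → P (n + 1) ∧ f n < f (n + 1)) :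
    ∃ n, P n ∧ Q n := by
  by_contra! hcon
  have hP : ∀ n, P n := fun n => Nat.rec h0 (fun n ih => (h n ih (hcon n ih)).1) n
  exact not_strictMono_of_wellFoundedGT f
    (strictMono_nat_of_lt_succ fun n => (h n (hP n) (hcon n (hP n))).2)

/-! ### Distance at most 6: convergence. -/

section SmallDistance

variable {V : Type u} {G : SimpleGraph V} {s t : V} {n : ℕ} {α β : ℝ}

/-- Provides the common neighbour that `IsMerged` demands after a collecting round. -/
theorem exists_near_of_not_bothUniversal {H : SimpleGraph V} (hc : H.Connected) (hst : s ≠ t)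
    (hb : ¬ BothUniversal H s t) :
    ∃ x, x ≠ s ∧ x ≠ t ∧ (H.edist s x ≤ (3 : ℕ) ∨ H.edist t x ≤ (3 : ℕ)) := by
  by_contra! hcon
  obtain ⟨y, hy, -⟩ := exists_adj_dist_add_one hc hst
  have hadj : H.Adj s t := by
    by_cases e : y = t
    · exact e ▸ hy
    · exact absurd (hy.edist_le_one.trans (by norm_num)) (not_le.2 (hcon y hy.ne' e).1)
  refine hb (bothUniversal_of_isHub hadj (isHub_of_forall_edist_le hc ?_)
    (isHub_of_forall_edist_le hc ?_))
  · exact fun x hs ht hx => absurd hx (not_le.2 (hcon x hs ht).2)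
  · exact fun x ht hs hx => absurd hx (not_le.2 (hcon x hs ht).1)

/-- One round of the collecting phase. -/
theorem collecting_step {H K : SimpleGraph V} (hc : H.Connected) (hst : s ≠ t)
    (hm : IsMerged H s t n) (hb : ¬ BothUniversal H s t)
    (hK : ∀ u v, u ≠ v → (K.Adj u v ↔ H.Adj u v ∨
      ((u = s ∨ u = t) ∧ (H.edist s v ≤ (3 : ℕ) ∨ H.edist t v ≤ (3 : ℕ))) ∨
      ((v = s ∨ v = t) ∧ (H.edist s u ≤ (3 : ℕ) ∨ H.edist t u ≤ (3 : ℕ))))) :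
    H < K ∧ IsMerged K s t (n + 1) ∧ ∀ u v, K.Adj u v → H.edist u v ≤ (15 : ℕ) := by
  have hst6 : H.edist s t ≤ (6 : ℕ) := by
    rcases hm with hm | hm
    · exact hm.2
    · exact hm.2.1.edist_le_one.trans (by norm_num)
  have hts6 : H.edist t s ≤ (6 : ℕ) := by rwa [edist_comm]
  have hle : H ≤ K := fun u v h => (hK u v h.ne).2 (Or.inl h)
  have hadj : K.Adj s t := (hK s t hst).2 (Or.inr (Or.inl ⟨Or.inl rfl, Or.inr (by simp)⟩))
  have hs : ∀ x, x ≠ s → (H.edist s x ≤ (3 : ℕ) ∨ H.edist t x ≤ (3 : ℕ)) → K.Adj s x :=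
    fun x hx h => (hK s x hx.symm).2 (Or.inr (Or.inl ⟨Or.inl rfl, h⟩))
  have ht : ∀ x, x ≠ t → (H.edist s x ≤ (3 : ℕ) ∨ H.edist t x ≤ (3 : ℕ)) → K.Adj t x :=
    fun x hx h => (hK t x hx.symm).2 (Or.inr (Or.inl ⟨Or.inr rfl, h⟩))
  refine ⟨lt_of_le_of_ne hle ?_, Or.inr ⟨n.succ_ne_zero, hadj, fun x hxs hxt => ?_, ?_⟩, ?_⟩
  -- If nothing is added, all nodes within distance 3 are already neighbours, so both nodes are
  -- universal.
  · rintro rfl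
    refine hb (bothUniversal_of_isHub hadj (isHub_of_forall_edist_le hc ?_)
      (isHub_of_forall_edist_le hc ?_))
    · exact fun x _ hxt hx => ht x hxt (Or.inr hx)
    · exact fun x _ hxs hx => hs x hxs (Or.inl hx)
  · constructor
    · intro h
      refine ht x hxt ?_
      rcases (hK s x hxs.symm).1 h with h | h | h
      · exact Or.inl (h.edist_le_one.trans (by norm_num))
      · exact h.2
      · exact (h.1.elim hxs hxt).elim
    · intro h
      refine hs x hxs ?_
      rcases (hK t x hxt.symm).1 h with h | h | h
      · exact Or.inr (h.edist_le_one.trans (by norm_num))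
      · exact h.2
      · exact (h.1.elim hxs hxt).elim
  · obtain ⟨x, hxs, hxt, hx⟩ := exists_near_of_not_bothUniversal hc hst hb
    exact ⟨x, hs x hxs hx, ht x hxt hx⟩
  -- The worst case is 6 + 3 = 9, from one of `s`, `t` through the other.
  · have key : ∀ u v, (u = s ∨ u = t) → (H.edist s v ≤ (3 : ℕ) ∨ H.edist t v ≤ (3 : ℕ)) →
        H.edist u v ≤ (15 : ℕ) := by
      rintro u v (rfl | rfl) (h | h)
      · exact h.trans (by norm_num)
      · exact (edist_le_add hst6 h).trans (by norm_num)
      · exact (edist_le_add hts6 h).trans (by norm_num)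
      · exact h.trans (by norm_num)
    intro u v h
    rcases (hK u v h.ne).1 h with h | h | h
    · exact h.edist_le_one.trans (by norm_num)
    · exact key u v h.1 h.2
    · rw [edist_comm]
      exact key v u h.1 h.2

theorem run_succ_eq (hα : 0 < α) (hαβ : α < β) {K : SimpleGraph V}
    (h : ∀ u v, u ≠ v → (NextAdj G ((sssdSystem α β).run G s t n) s t n u v ↔ K.Adj u v)) :
    (sssdSystem α β).run G s t (n + 1) = K := by
  ext u v
  by_cases huv : u = v
  · subst huv
    simp
  · rw [run_succ_adj hα hαβ G s t n huv, h u v huv]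

theorem run_eq_of_le {L : SimpleGraph V} {m : ℕ}
    (h : ∀ n, m ≤ n → (sssdSystem α β).run G s t n = L → (sssdSystem α β).run G s t (n + 1) = L)
    (hm : (sssdSystem α β).run G s t m = L) :
    ∀ n, m ≤ n → (sssdSystem α β).run G s t n = L := by
  intro n hn
  induction n, hn using Nat.le_induction with
  | base => exact hm
  | succ n hn ih => exact h n hn ih

theorem run_solution_of_isSettled (hα : 0 < α) (hαβ : α < β) (hc : G.Connected) (hst : s ≠ t)
    (hD : G.dist s t ≠ 2) (hn : n ≠ 0) (h : (sssdSystem α β).run G s t n = solution G s t) :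
    (sssdSystem α β).run G s t (n + 1) = solution G s t := by
  refine run_succ_eq hα hαβ fun u v huv => ?_
  have hs := isSettled_solution hc hst hD
  rw [h, NextAdj, locallyWants_of_isSettled hn hs, ← view_comm, locallyWants_of_isSettled hn hs,
    adj_comm _ v u, or_self, ← or_and_right]
  exact and_iff_right (em _)

theorem run_solution_of_dist_le (hα : 0 < α) (hαβ : α < β) (hc : G.Connected) (hst : s ≠ t)
    (hD : G.dist s t ≤ 6) (hn : n ≠ 0) (h : (sssdSystem α β).run G s t n = solution G s t) :
    (sssdSystem α β).run G s t (n + 1) = solution G s t := by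
  by_cases hD2 : G.dist s t = 2
  · refine run_succ_eq hα hαβ fun u v huv => ?_
    rw [h, nextAdj_of_dist_le hD huv]
    have hw := fun {u v : V} (h : u ≠ v) => solution_adj_of_locallyWants (n := n) hc hst hD2 hn h
    have hadj : (solution G s t).Adj s t := (solution_adj hst).2 (Or.inr (Or.inl ⟨rfl, rfl⟩))
    have hsp : ∀ {u v}, (shortestPathGraph G s t).Adj u v → (solution G s t).Adj u v :=
      fun h => (solution_adj hst).2 (Or.inl h)
    constructor
    · rintro (⟨-, h | h⟩ | ⟨h, -⟩)
      · exact hw huv h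
      · rw [← view_comm] at h
        exact (hw huv.symm h).symm
      · exact hsp h
    · intro h'
      by_cases hsp' : (shortestPathGraph G s t).Adj u v
      · exact Or.inr ⟨hsp', h'⟩
      · refine Or.inl ⟨hsp', ?_⟩
        have key := locallyWants_solution_source_target hc hst hD2 hn
        rcases (solution_adj hst).1 h' with h | ⟨rfl, rfl⟩ | ⟨rfl, rfl⟩
        · exact absurd h hsp'
        · exact Or.inl key
        · rw [← view_comm] at key
          exact Or.inr key
  · exact run_solution_of_isSettled hα hαβ hc hst hD2 hn h

theorem isMerged_zero (hc : G.Connected) (hD : G.dist s t ≤ 6) : IsMerged G s t 0 := by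
  refine Or.inl ⟨rfl, ?_⟩
  rw [← (hc.preconnected s t).coe_dist_eq_edist]
  exact_mod_cast hD

theorem collecting_succ (hα : 0 < α) (hαβ : α < β) (hc : G.Connected) (hst : s ≠ t)
    (hD : G.dist s t ≤ 6) (hle : G ≤ (sssdSystem α β).run G s t n)
    (hm : IsMerged ((sssdSystem α β).run G s t n) s t n)
    (hb : ¬ BothUniversal ((sssdSystem α β).run G s t n) s t) :
    (sssdSystem α β).run G s t n < (sssdSystem α β).run G s t (n + 1) ∧
      IsMerged ((sssdSystem α β).run G s t (n + 1)) s t (n + 1) ∧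
      ∀ u v, ((sssdSystem α β).run G s t (n + 1)).Adj u v →
        ((sssdSystem α β).run G s t n).edist u v ≤ (15 : ℕ) := by
  refine collecting_step (hc.mono hle) hst hm hb fun u v huv => ?_
  rw [run_succ_adj hα hαβ G s t n huv, nextAdj_of_isMerged hD (hc.mono hle) hst hle hm hb huv]

theorem collecting_end (hα : 0 < α) (hαβ : α < β) (hst : s ≠ t)
    (hD : G.dist s t ≤ 6) (hle : G ≤ (sssdSystem α β).run G s t n)
    (hm : IsMerged ((sssdSystem α β).run G s t n) s t n)
    (hb : BothUniversal ((sssdSystem α β).run G s t n) s t) :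
    (sssdSystem α β).run G s t (n + 1) = solution G s t :=
  run_succ_eq hα hαβ fun _ _ huv => nextAdj_of_bothUniversal hD hst hle hm hb huv

theorem collecting_or_eq_solution (hα : 0 < α) (hαβ : α < β) (hc : G.Connected) (hst : s ≠ t)
    (hD : G.dist s t ≤ 6) (n : ℕ) :
    (G ≤ (sssdSystem α β).run G s t n ∧ IsMerged ((sssdSystem α β).run G s t n) s t n) ∨
      (n ≠ 0 ∧ (sssdSystem α β).run G s t n = solution G s t) := by
  induction n with
  | zero => exact Or.inl ⟨le_rfl, isMerged_zero hc hD⟩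
  | succ n ih =>
    rcases ih with ⟨hle, hm⟩ | ⟨hn, h⟩
    · by_cases hb : BothUniversal ((sssdSystem α β).run G s t n) s t
      · exact Or.inr ⟨n.succ_ne_zero, collecting_end hα hαβ hst hD hle hm hb⟩
      · have := collecting_succ hα hαβ hc hst hD hle hm hb
        exact Or.inl ⟨hle.trans this.1.le, this.2.1⟩
    · exact Or.inr ⟨n.succ_ne_zero, run_solution_of_dist_le hα hαβ hc hst hD hn h⟩

theorem convergesTo_of_dist_le [Finite V] (hα : 0 < α) (hαβ : α < β) (hc : G.Connected)
    (hst : s ≠ t) (hD : G.dist s t ≤ 6) :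
    (sssdSystem α β).ConvergesTo G s t (solution G s t) := by
  constructor
  · obtain ⟨n, ⟨hle, hm⟩, hb⟩ := exists_of_forall_lt_or ((sssdSystem α β).run G s t)
      (fun n => G ≤ (sssdSystem α β).run G s t n ∧ IsMerged ((sssdSystem α β).run G s t n) s t n)
      (fun n => BothUniversal ((sssdSystem α β).run G s t n) s t)
      ⟨le_rfl, isMerged_zero hc hD⟩ (fun n h hb => by
        have := collecting_succ hα hαβ hc hst hD h.1 h.2 hb
        exact ⟨⟨h.1.trans this.1.le, this.2.1⟩, this.1⟩)
    exact ⟨n + 1, run_eq_of_le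
      (fun m hm h => run_solution_of_dist_le hα hαβ hc hst hD (by omega) h)
      (collecting_end hα hαβ hst hD hle hm hb)⟩
  · intro n hn
    rcases collecting_or_eq_solution hα hαβ hc hst hD n with ⟨hle, hm⟩ | h
    · by_cases hb : BothUniversal ((sssdSystem α β).run G s t n) s t
      · exact hn.trans (collecting_end hα hαβ hst hD hle hm hb)
      · exact absurd hn (collecting_succ hα hαβ hc hst hD hle hm hb).1.ne
    · exact h.2

theorem connectsWithin_of_dist_le (hα : 0 < α) (hαβ : α < β) (hc : G.Connected)
    (hst : s ≠ t) (hD : G.dist s t ≤ 6) : (sssdSystem α β).ConnectsWithin 15 G s t := by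
  intro n u v h
  rcases collecting_or_eq_solution hα hαβ hc hst hD n with ⟨hle, hm⟩ | ⟨hn, hL⟩
  · by_cases hb : BothUniversal ((sssdSystem α β).run G s t n) s t
    · exact (edist_le_of_adj_all hb.1 u v).trans (by norm_num)
    · exact (collecting_succ hα hαβ hc hst hD hle hm hb).2.2 u v h
  · rw [run_solution_of_dist_le hα hαβ hc hst hD hn hL, ← hL] at h
    exact h.edist_le_one.trans (by norm_num)

end SmallDistance

/-! ### Distance more than 6: single rounds. -/

section LargeDistance

variable {V : Type u} {G H K : SimpleGraph V} {s t u v : V} {n : ℕ} {α β : ℝ}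

theorem SimpleGraph.Adj.dist_le_dist_add_one (hc : G.Connected) (h : G.Adj u v) (t : V) :
    G.dist u t ≤ G.dist v t + 1 := by
  have := hc.dist_triangle (u := u) (v := v) (w := t)
  rw [dist_eq_one_iff_adj.2 h] at this
  omega

/-- The first steps on a shortest path. -/
theorem exists_initial_path (hc : G.Connected) (hD : 6 < G.dist s t) :
    ∃ x y z, G.Adj s x ∧ G.Adj x y ∧ G.Adj y z ∧ G.dist x t + 1 = G.dist s t ∧
      G.dist y t + 2 = G.dist s t ∧ G.dist z t + 3 = G.dist s t := by
  have ne : ∀ {a}, 0 < G.dist a t → a ≠ t := by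
    rintro a h rfl
    simp at h
  obtain ⟨x, hx, hx'⟩ := exists_adj_dist_add_one hc (ne (a := s) (by omega))
  obtain ⟨y, hy, hy'⟩ := exists_adj_dist_add_one hc (ne (a := x) (by omega))
  obtain ⟨z, hz, hz'⟩ := exists_adj_dist_add_one hc (ne (a := y) (by omega))
  exact ⟨x, y, z, hx, hy, hz, hx', by omega, by omega⟩

/-- The last step on a shortest path. -/
theorem exists_shortestPathGraph_adj_target (hc : G.Connected) (hst : s ≠ t) :
    ∃ z, (shortestPathGraph G s t).Adj t z ∧ G.dist z s + 1 = G.dist s t := by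
  obtain ⟨z, hz, hz'⟩ := exists_adj_dist_add_one hc hst.symm
  rw [dist_comm (u := t)] at hz'
  refine ⟨z, (shortestPathGraph_adj_iff hc).2 ⟨hz, Or.inr ?_⟩, hz'⟩
  rw [dist_self, dist_comm, add_zero, hz']

/-- The node after `v` on a geodesic is two steps closer to `t` than `s` is, so it is not adjacent
to `s`. Hence forgetting the other neighbours of `s` costs no shortest path. -/
theorem isExit_of_shortestPathGraph_adj (hc : G.Connected) (hD : 6 < G.dist s t)
    (h : (shortestPathGraph G s t).Adj s v) : IsExit G s t v := by
  have h1 := (shortestPathGraph_adj_iff hc).1 h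
  have h2 := h1.2
  rw [dist_self] at h2
  have hv : v ≠ t := by
    rintro rfl
    rw [dist_self] at h2
    omega
  obtain ⟨y, hy, hy'⟩ := exists_adj_dist_add_one hc hv
  refine ⟨h1.1, y, ?_, ?_, hy, fun h => ?_⟩
  · rintro rfl
    omega
  · rintro rfl
    rw [dist_self] at hy'
    omega
  · have := h.dist_le_dist_add_one hc t
    omega

/-- `H` arises from `G` by adding edges at `t`. -/
def ExtendsAt (G H : SimpleGraph V) (t : V) : Prop :=
  G ≤ H ∧ ∀ u v, u ≠ t → v ≠ t → H.Adj u v → G.Adj u v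

theorem alternatingInteraction_adj_even (hD : 6 < G.dist s t) (hn : Even n) (huv : u ≠ v) :
    (alternatingInteraction G s t n).Adj u v ↔ ¬ (G.Adj u v ∧ (u = t ∨ v = t)) := by
  rw [alternatingInteraction, if_neg (not_le.2 hD), if_pos hn, compl_adj]
  exact and_iff_right huv

theorem alternatingInteraction_adj_odd (hD : 6 < G.dist s t) (hn : ¬ Even n) (huv : u ≠ v) :
    (alternatingInteraction G s t n).Adj u v ↔ ¬ (G.Adj u v ∧ (u = s ∨ v = s)) := by
  rw [alternatingInteraction, if_neg (not_le.2 hD), if_neg hn, compl_adj]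
  exact and_iff_right huv

theorem adj_of_not_alternatingInteraction_adj (hD : 6 < G.dist s t) (huv : u ≠ v)
    (h : ¬ (alternatingInteraction G s t n).Adj u v) : G.Adj u v := by
  by_cases hn : Even n
  · rw [alternatingInteraction_adj_even hD hn huv, not_not] at h
    exact h.1
  · rw [alternatingInteraction_adj_odd hD hn huv, not_not] at h
    exact h.1

theorem not_adj_of_dist (hD : 6 < G.dist s t) : ¬ G.Adj s t := by
  intro h
  rw [dist_eq_one_iff_adj.2 h] at hD
  omega

/-! ### The target grows. -/

section Growing

/-- The witness is the node `z` three steps along a geodesic. New edges are only at `t`, so two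
steps from `s` avoiding `t` are steps of `G` and come at most 2 closer to `t`. -/
theorem nextAdj_of_not_isHub (hc : G.Connected) (hD : 6 < G.dist s t) (hH : ExtendsAt G H t)
    (hst : ¬ H.Adj s t) (h0 : n = 0 → H = G) (hh : ¬ IsHub H s t) (huv : u ≠ v) :
    NextAdj G H s t n u v ↔ H.Adj u v ∨ (u = t ∧ v ≠ s ∧ H.edist t v ≤ (3 : ℕ)) ∨
      (v = t ∧ u ≠ s ∧ H.edist t u ≤ (3 : ℕ)) := by
  obtain ⟨x, y, z, hx, hy, hz, hx', hy', hz'⟩ := exists_initial_path hc hD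
  have hzt : z ≠ t := by
    rintro rfl
    rw [dist_self] at hz'
    omega
  have hzs : z ≠ s := by
    rintro rfl
    omega
  have hs : s ≠ t := by
    rintro rfl
    simp at hD
  have h6 : n = 0 → ¬ H.edist s t ≤ (6 : ℕ) := by
    intro hn
    rw [h0 hn, ← (hc.preconnected s t).coe_dist_eq_edist]
    exact_mod_cast not_le.2 hD
  have h3 : H.edist s z ≤ (3 : ℕ) :=
    edist_le_add (edist_le_add (hH.1 hx).edist_le_one (hH.1 hy).edist_le_one)
      (hH.1 hz).edist_le_one
  have h1 : ¬ H.Adj s z := fun h => by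
    have := (hH.2 s z hs hzt h).dist_le_dist_add_one hc t
    omega
  have h2 : ∀ y, y ≠ t → H.Adj s y → ¬ H.Adj y z := fun y hyt h h' => by
    have := (hH.2 s y hs hyt h).dist_le_dist_add_one hc t
    have := (hH.2 y z hyt hzt h').dist_le_dist_add_one hc t
    omega
  have key := locallyWants_of_not_isHub (hc.mono hH.1) hst h6 hh h3 hzs hzt h1 h2 huv
  have key' := locallyWants_of_not_isHub (hc.mono hH.1) hst h6 hh h3 hzs hzt h1 h2 huv.symm
  rw [NextAdj, key, ← view_comm, key', H.adj_comm v u]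
  by_cases h : (alternatingInteraction G s t n).Adj u v
  · simp only [h, true_and, not_true, false_and, or_false]
    rw [or_or_or_comm, or_self]
  · have hadj : H.Adj u v := hH.1 (adj_of_not_alternatingInteraction_adj hD huv h)
    simp [h, hadj]

theorem growing_step (hc : G.Connected) (hH : ExtendsAt G H t) (hst : ¬ H.Adj s t)
    (hne : s ≠ t) (hh : ¬ IsHub H s t)
    (hK : ∀ u v, u ≠ v → (K.Adj u v ↔ H.Adj u v ∨ (u = t ∧ v ≠ s ∧ H.edist t v ≤ (3 : ℕ)) ∨
      (v = t ∧ u ≠ s ∧ H.edist t u ≤ (3 : ℕ)))) :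
    H < K ∧ ExtendsAt G K t ∧ ¬ K.Adj s t ∧ ∀ u v, K.Adj u v → H.edist u v ≤ (15 : ℕ) := by
  have hle : H ≤ K := fun u v h => (hK u v h.ne).2 (Or.inl h)
  refine ⟨lt_of_le_of_ne hle ?_, ⟨hH.1.trans hle, fun u v hu hv h => ?_⟩, fun h => ?_,
    fun u v h => ?_⟩
  · rintro rfl
    exact hh (isHub_of_forall_edist_le (hc.mono hH.1) fun x hxs hxt hx =>
      (hK t x hxt.symm).2 (Or.inr (Or.inl ⟨rfl, hxs, hx⟩)))
  · have := (hK u v h.ne).1 h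
    exact hH.2 u v hu hv (by tauto)
  · have := (hK s t hne).1 h
    tauto
  · rcases (hK u v h.ne).1 h with h | ⟨rfl, -, h⟩ | ⟨rfl, -, h⟩
    · exact h.edist_le_one.trans (by norm_num)
    · exact h.trans (by norm_num)
    · rw [edist_comm]
      exact h.trans (by norm_num)

end Growing

/-! ### The target is adjacent to all nodes except possibly the source. -/

section Hub

theorem edist_le_of_isHub (hc : G.Connected) (hD : 6 < G.dist s t) (hH : ExtendsAt G H t)
    (hh : IsHub H s t) (x y : V) : H.edist x y ≤ (4 : ℕ) := by
  have key : ∀ x, H.edist t x ≤ (2 : ℕ) := by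
    intro x
    by_cases hxt : x = t
    · simp [hxt]
    by_cases hxs : x = s
    · obtain ⟨y, _, _, hy, -, -, hy', -⟩ := exists_initial_path hc hD
      have hyt : y ≠ t := by
        rintro rfl
        rw [dist_self] at hy'
        omega
      rw [hxs]
      exact edist_le_add (hh y hy.ne' hyt).edist_le_one (hH.1 hy).symm.edist_le_one
    · exact (hh x hxs hxt).edist_le_one.trans (by norm_num)
  refine edist_le_add (b := t) (i := 2) (j := 2) ?_ (key y)
  rw [edist_comm]
  exact key x

/-- The earlier tests fail even if `s` and `t` are already adjacent: the first node `x` of a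
geodesic is a common neighbour, while the last node `z` before `t` is adjacent to `t` but not within
2 of `s` off `t`. -/
theorem wants_of_isHub (hc : G.Connected) (hD : 6 < G.dist s t) (hH : ExtendsAt G H t)
    (hh : IsHub H s t) (hn : n ≠ 0) :
    Wants H s t n u v ↔ if Even n then (u = s ∧ v ≠ s ∧ v ≠ t ∧ ¬ IsExit H s t v) ∨
        ((u ≠ s ∧ u ≠ t) ∧ (v ≠ s ∧ v ≠ t) ∧ H.Adj u v)
      else H.Adj u v ∨ (u = s ∧ v = t) := by
  have hs : s ≠ t := by
    rintro rfl
    simp at hD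
  obtain ⟨x, _, _, hx, -, -, hx', -⟩ := exists_initial_path hc hD
  obtain ⟨z, hz, hz'⟩ := exists_shortestPathGraph_adj_target hc hs
  have hz := shortestPathGraph_le _ _ _ hz
  have hxt : x ≠ t := by
    rintro rfl
    rw [dist_self] at hx'
    omega
  have hzs : z ≠ s := by
    rintro rfl
    rw [dist_self] at hz'
    omega
  have hsz : ¬ H.Adj s z := fun h => by
    have := dist_eq_one_iff_adj.2 (hH.2 s z hs hz.ne' h).symm
    omega
  have h1 : ¬ IsMerged H s t n := by
    rintro (h | h)
    · exact hn h.1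
    · exact hsz ((h.2.2.1 z hzs hz.ne').2 (hH.1 hz))
  have h2 : ¬ IsSettled H s t := fun h => h.2 ⟨x, hH.1 hx, hh x hx.ne' hxt⟩
  have h3 : ¬ CoversInTwo H s t := by
    intro h
    rcases h z hzs hz.ne' with h | ⟨y, hyt, h, h'⟩
    · exact hsz h
    · have := dist_eq_one_iff_adj.2 (hH.2 s y hs hyt h).symm
      have := (hH.2 y z hyt hz.ne' h').symm.dist_le_dist_add_one hc s
      omega
  rw [Wants, if_neg h1, if_neg hn, if_neg h2, if_neg h3, if_pos hh]

/-- The graph in which the neighbourhood of the source is replaced by the set of all nodes, other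
than the target, through which no shortest path leaves the source. -/
def detour (G : SimpleGraph V) (s t : V) : SimpleGraph V where
  Adj u v := u ≠ v ∧ ((u ≠ s ∧ v ≠ s ∧ G.Adj u v) ∨ (u = s ∧ v ≠ t ∧ ¬ IsExit G s t v) ∨
    (v = s ∧ u ≠ t ∧ ¬ IsExit G s t u))
  symm := ⟨fun u v h => by
    rw [G.adj_comm v u]
    tauto⟩
  loopless := ⟨fun _ h => h.1 rfl⟩

/-- Here the frozen edges act as memory: they are all that remains at `t`, so its neighbourhood in
`G` returns while `s` takes over as centre. -/
theorem nextAdj_of_isHub_even (hc : G.Connected) (hD : 6 < G.dist s t) (hH : ExtendsAt G H t)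
    (hh : IsHub H s t) (hn : n ≠ 0) (he : Even n) (huv : u ≠ v) :
    NextAdj G H s t n u v ↔ (detour G s t).Adj u v := by
  have hs : s ≠ t := by
    rintro rfl
    simp at hD
  have hGst := not_adj_of_dist hD
  have hadj : ∀ u v, u ≠ t → v ≠ t → (H.Adj u v ↔ G.Adj u v) := fun u v hu hv =>
    ⟨hH.2 u v hu hv, fun h => hH.1 h⟩
  -- Being an exit involves no edge at `t`, so the growth of `t` does not affect it.
  have hex : ∀ v, v ≠ t → (IsExit H s t v ↔ IsExit G s t v) := by
    intro v hv
    refine and_congr (hadj s v hs hv) (exists_congr fun y => and_congr_right fun _ =>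
      and_congr_right fun hy => ?_)
    rw [hadj v y hv hy, hadj s y hs hy]
  rw [nextAdj_of_forall_edist_le
    (fun x y => (edist_le_of_isHub hc hD hH hh x y).trans (by norm_num [sight])),
    alternatingInteraction_adj_even hD he huv, wants_of_isHub hc hD hH hh hn,
    wants_of_isHub hc hD hH hh hn, if_pos he, if_pos he]
  have hle : G.Adj u v → H.Adj u v := fun h => hH.1 h
  have h1 := hex u
  have h2 := hex v
  have h3 := hadj u v
  have h4 : u = s → v = t → ¬ G.Adj u v := by
    rintro rfl rfl
    exact hGst
  have h5 : u = t → v = s → ¬ G.Adj u v := by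
    rintro rfl rfl h
    exact hGst h.symm
  simp only [detour, H.adj_comm v u]
  have huv' := huv.symm
  have hs' := hs.symm
  clear hex hadj hH hh hc hD
  by_cases a1 : u = s
  · subst a1
    by_cases a2 : v = t <;> simp_all
  · by_cases a2 : u = t
    · subst a2
      by_cases a3 : v = s <;> simp_all
    · by_cases a3 : v = s
      · subst a3
        simp_all
      · by_cases a4 : v = t <;> simp_all

/-- A waiting round: the added edge changes the parity of the time without a halt. -/
theorem nextAdj_of_isHub_odd (hc : G.Connected) (hD : 6 < G.dist s t) (hH : ExtendsAt G H t)
    (hh : IsHub H s t) (hn : n ≠ 0) (he : ¬ Even n) (huv : u ≠ v) :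
    NextAdj G H s t n u v ↔ H.Adj u v ∨ (u = s ∧ v = t) ∨ (v = s ∧ u = t) := by
  rw [nextAdj_of_forall_edist_le
    (fun x y => (edist_le_of_isHub hc hD hH hh x y).trans (by norm_num [sight])),
    wants_of_isHub hc hD hH hh hn, wants_of_isHub hc hD hH hh hn, if_neg he, if_neg he,
    H.adj_comm v u]
  have := adj_of_not_alternatingInteraction_adj (n := n) hD huv
  have hle : G.Adj u v → H.Adj u v := fun h => hH.1 h
  tauto

end Hub

/-! ### The source holds the graph together while the shortest paths are extracted. -/

section Detour

/-- The detour graph, in which the target keeps only its edges on shortest paths, with a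
source-target edge. -/
def markedDetour (G : SimpleGraph V) (s t : V) : SimpleGraph V where
  Adj u v := u ≠ v ∧ (((detour G s t).Adj u v ∧
    (u = t ∨ v = t → (shortestPathGraph G s t).Adj u v)) ∨ (u = s ∧ v = t) ∨ (v = s ∧ u = t))
  symm := ⟨fun u v h => by
    rw [(detour G s t).adj_comm v u, (shortestPathGraph G s t).adj_comm v u]
    tauto⟩
  loopless := ⟨fun _ h => h.1 rfl⟩

theorem detour_adj (hu : u ≠ s) (hv : v ≠ s) : (detour G s t).Adj u v ↔ G.Adj u v := by
  have := G.ne_of_adj (a := u) (b := v)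
  simp only [detour]
  tauto

theorem detour_adj_source (hv : v ≠ s) (hvt : v ≠ t) :
    (detour G s t).Adj s v ↔ ¬ IsExit G s t v := by
  have := hv.symm
  simp only [detour]
  tauto

theorem not_detour_adj (hst : s ≠ t) : ¬ (detour G s t).Adj s t := by
  have := hst.symm
  simp only [detour]
  tauto

theorem markedDetour_adj (hu : u ≠ s) (hv : v ≠ s) : (markedDetour G s t).Adj u v ↔
    G.Adj u v ∧ (u = t ∨ v = t → (shortestPathGraph G s t).Adj u v) := by
  have := G.ne_of_adj (a := u) (b := v)
  simp only [markedDetour, detour_adj hu hv]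
  tauto

theorem markedDetour_adj_source (hst : s ≠ t) (hv : v ≠ s) (hvt : v ≠ t) :
    (markedDetour G s t).Adj s v ↔ ¬ IsExit G s t v := by
  have := hv.symm
  simp only [markedDetour, detour_adj_source hv hvt]
  tauto

/-- After flipping, the neighbours of `s` are its exits in `G`. The flipped graph lies between
`shortestPathGraph G s t` and `G`, so `shortestPathGraph_eq_of_le` applies. -/
theorem shortestPathGraph_flipSource (hc : G.Connected) (hD : 6 < G.dist s t)
    (hsource : ∀ x, x ≠ s → x ≠ t → (H.Adj s x ↔ ¬ IsExit G s t x))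
    (hle : ∀ u v, u ≠ s → v ≠ s → H.Adj u v → G.Adj u v)
    (hsp : ∀ u v, u ≠ s → v ≠ s → (shortestPathGraph G s t).Adj u v → H.Adj u v) :
    shortestPathGraph (flipSource H s t) s t = shortestPathGraph G s t := by
  refine shortestPathGraph_eq_of_le (hc.preconnected s t) ?_ ?_
  · have key : ∀ v, (shortestPathGraph G s t).Adj s v → (flipSource H s t).Adj s v := by
      intro v h
      have hex := isExit_of_shortestPathGraph_adj hc hD h
      have hvt : v ≠ t := by
        rintro rfl
        exact not_adj_of_dist hD hex.1
      exact ⟨h.ne, Or.inr ⟨Or.inl ⟨rfl, hvt⟩, fun h' => (hsource v h.ne' hvt).1 h' hex⟩⟩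
    intro u v h
    by_cases hu : u = s
    · subst hu
      exact key v h
    by_cases hv : v = s
    · subst hv
      exact (key u h.symm).symm
    exact ⟨h.ne, Or.inl ⟨hu, hv, hsp u v hu hv h⟩⟩
  · have key : ∀ v, v ≠ s → v ≠ t → ¬ H.Adj s v → G.Adj s v := fun v hv hvt h =>
      (not_not.1 fun h' => h ((hsource v hv hvt).2 h') : IsExit G s t v).1
    rintro u v ⟨huv, ⟨hu, hv, h⟩ | ⟨⟨rfl, hvt⟩ | ⟨rfl, hut⟩, h⟩⟩
    · exact hle u v hu hv h
    · exact key v huv.symm hvt h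
    · exact (key u huv hut fun h' => h h'.symm).symm

/-- An exit has a neighbour that was not adjacent to `s`; that neighbour is no exit, so `s` now
reaches the exit through it. Complementing the full neighbourhood could strand neighbours of `s`
that are not exits. -/
theorem coversInTwo_of_adj
    (hsource : ∀ x, x ≠ s → x ≠ t → (H.Adj s x ↔ ¬ IsExit G s t x))
    (hinner : ∀ u v, u ≠ s → v ≠ s → u ≠ t → v ≠ t → G.Adj u v → H.Adj u v) :
    CoversInTwo H s t := by
  intro x hxs hxt
  by_cases hx : IsExit G s t x
  · obtain ⟨y, hys, hyt, hxy, hy⟩ := hx.2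
    exact Or.inr ⟨y, hyt, (hsource y hys hyt).2 fun h => hy h.1,
      hinner y x hys hxs hyt hxt hxy.symm⟩
  · exact Or.inl ((hsource x hxs hxt).2 hx)

theorem edist_le_of_coversInTwo {z : V} (h : CoversInTwo H s t) (hz : H.Adj t z) (x y : V) :
    H.edist x y ≤ (6 : ℕ) := by
  have near : ∀ x, x ≠ t → H.edist s x ≤ (2 : ℕ) := by
    intro x hxt
    by_cases hxs : x = s
    · simp [hxs]
    rcases h x hxs hxt with h | ⟨y, -, h, h'⟩
    · exact h.edist_le_one.trans (by norm_num)
    · exact edist_le_add h.edist_le_one h'.edist_le_one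
  have key : ∀ x, H.edist s x ≤ (3 : ℕ) := by
    intro x
    by_cases hxt : x = t
    · rw [hxt]
      exact edist_le_add (near z hz.ne') hz.symm.edist_le_one
    · exact (near x hxt).trans (by norm_num)
  refine edist_le_add (b := s) (i := 3) (j := 3) ?_ (key y)
  rw [edist_comm]
  exact key x

theorem detour_coversInTwo : CoversInTwo (detour G s t) s t :=
  coversInTwo_of_adj (fun _ hx hxt => detour_adj_source hx hxt)
    fun _ _ hu hv _ _ h => (detour_adj hu hv).2 h

theorem markedDetour_coversInTwo (hst : s ≠ t) : CoversInTwo (markedDetour G s t) s t :=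
  coversInTwo_of_adj (fun _ hx hxt => markedDetour_adj_source hst hx hxt)
    fun _ _ hu hv hut hvt h => (markedDetour_adj hu hv).2 ⟨h, fun h => (h.elim hut hvt).elim⟩

theorem detour_edist_le (hc : G.Connected) (hD : 6 < G.dist s t) (x y : V) :
    (detour G s t).edist x y ≤ (6 : ℕ) := by
  have hst : s ≠ t := by
    rintro rfl
    simp at hD
  obtain ⟨z, hz, hz'⟩ := exists_shortestPathGraph_adj_target hc hst
  have hzs : z ≠ s := by
    rintro rfl
    exact not_adj_of_dist hD (shortestPathGraph_le _ _ _ hz).symm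
  exact edist_le_of_coversInTwo detour_coversInTwo
    ((detour_adj hst.symm hzs).2 (shortestPathGraph_le _ _ _ hz)) x y

theorem markedDetour_edist_le (hc : G.Connected) (hD : 6 < G.dist s t) (x y : V) :
    (markedDetour G s t).edist x y ≤ (6 : ℕ) := by
  have hst : s ≠ t := by
    rintro rfl
    simp at hD
  obtain ⟨z, hz, hz'⟩ := exists_shortestPathGraph_adj_target hc hst
  have hzs : z ≠ s := by
    rintro rfl
    exact not_adj_of_dist hD (shortestPathGraph_le _ _ _ hz).symm
  exact edist_le_of_coversInTwo (markedDetour_coversInTwo hst)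
    ((markedDetour_adj hst.symm hzs).2 ⟨shortestPathGraph_le _ _ _ hz, fun _ => hz⟩) x y

theorem wants_detour (hc : G.Connected) (hD : 6 < G.dist s t) (he : ¬ Even n) :
    Wants (detour G s t) s t n u v ↔ (u = s ∧ v = t) ∨
      ((detour G s t).Adj u v ∧ (u = t ∨ v = t → (shortestPathGraph G s t).Adj u v)) := by
  have hst : s ≠ t := by
    rintro rfl
    simp at hD
  have hn : n ≠ 0 := by
    rintro rfl
    exact he Even.zero
  have h1 : ¬ IsMerged (detour G s t) s t n := by
    rintro (h | h)
    · exact hn h.1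
    · exact not_detour_adj hst h.2.1
  have h2 : ¬ IsSettled (detour G s t) s t := fun h => not_detour_adj hst h.1
  rw [Wants, if_neg h1, if_neg hn, if_neg h2, if_pos detour_coversInTwo, if_neg he,
    shortestPathGraph_flipSource hc hD (fun x hx hxt => detour_adj_source hx hxt)
      (fun u v hu hv h => (detour_adj hu hv).1 h)
      (fun u v hu hv h => (detour_adj hu hv).2 (shortestPathGraph_le _ _ _ h))]

/-- The initial edges at `t` are free at odd times and can be pruned. The frozen pairs at `s` do no
harm, since pairs away from `t` are to keep their status anyway. -/
theorem nextAdj_detour (hc : G.Connected) (hD : 6 < G.dist s t) (he : ¬ Even n) (huv : u ≠ v) :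
    NextAdj G (detour G s t) s t n u v ↔ (markedDetour G s t).Adj u v := by
  have hst : s ≠ t := by
    rintro rfl
    simp at hD
  have hGst := not_adj_of_dist hD
  rw [nextAdj_of_forall_edist_le
    (fun x y => (detour_edist_le hc hD x y).trans (by norm_num [sight])),
    alternatingInteraction_adj_odd hD he huv, wants_detour hc hD he, wants_detour hc hD he,
    adj_comm _ v u, adj_comm (shortestPathGraph G s t) v u]
  have h1 : ¬ (G.Adj u v ∧ (u = s ∨ v = s) ∧ (u = t ∨ v = t)) := by
    rintro ⟨h, e | e, e' | e'⟩
    · exact hst (e.symm.trans e')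
    · exact hGst (e ▸ e' ▸ h)
    · exact hGst (e ▸ e' ▸ h.symm)
    · exact hst (e.symm.trans e')
  simp only [markedDetour]
  generalize (detour G s t).Adj u v = a at *
  generalize (shortestPathGraph G s t).Adj u v = b at *
  generalize G.Adj u v = c at *
  by_cases a1 : u = s <;> by_cases a2 : u = t <;> by_cases a3 : v = s <;> by_cases a4 : v = t <;>
    by_cases a5 : c <;> simp_all

/-- Although `s` and `t` are now adjacent, the second geodesic node `y` is joined to `s` and not to
`t`, and the last one `z` is joined to both, so the graph is neither merged nor settled. -/
theorem wants_markedDetour (hc : G.Connected) (hD : 6 < G.dist s t) (hn : n ≠ 0) (he : Even n) :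
    Wants (markedDetour G s t) s t n u v ↔
      (u = s ∧ v = t) ∨ (shortestPathGraph G s t).Adj u v := by
  have hst : s ≠ t := by
    rintro rfl
    simp at hD
  have hsource := fun x hx hxt => markedDetour_adj_source (G := G) (v := x) hst hx hxt
  obtain ⟨x, y, _, hx, hy, -, hx', hy', -⟩ := exists_initial_path hc hD
  obtain ⟨z, hz, hz'⟩ := exists_shortestPathGraph_adj_target hc hst
  have hys : y ≠ s := by
    rintro rfl
    omega
  have hyt : y ≠ t := by
    rintro rfl
    rw [dist_self] at hy'
    omega
  have hzs : z ≠ s := by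
    rintro rfl
    rw [dist_self] at hz'
    omega
  have h1 : ¬ IsMerged (markedDetour G s t) s t n := by
    rintro (h | h)
    · exact hn h.1
    · have hsy : (markedDetour G s t).Adj s y := (hsource y hys hyt).2 fun h => by
        have := h.1.dist_le_dist_add_one hc t
        omega
      have := dist_eq_one_iff_adj.2
        ((markedDetour_adj hst.symm hys).1 ((h.2.2.1 y hys hyt).1 hsy)).1.symm
      omega
  have h2 : ¬ IsSettled (markedDetour G s t) s t := fun h => by
    refine h.2 ⟨z, (hsource z hzs hz.ne').2 fun h => ?_,
      (markedDetour_adj hst.symm hzs).2 ⟨shortestPathGraph_le _ _ _ hz, fun _ => hz⟩⟩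
    have := dist_eq_one_iff_adj.2 h.1.symm
    omega
  rw [Wants, if_neg h1, if_neg hn, if_neg h2, if_pos (markedDetour_coversInTwo hst), if_pos he,
    shortestPathGraph_flipSource hc hD hsource
      (fun u v hu hv h => ((markedDetour_adj hu hv).1 h).1)
      (fun u v hu hv h => (markedDetour_adj hu hv).2
        ⟨shortestPathGraph_le _ _ _ h, fun _ => h⟩)]

/-- The frozen pairs at `t` already have their final status from the round before; all others are
free to take it. -/
theorem nextAdj_markedDetour (hc : G.Connected) (hD : 6 < G.dist s t) (hn : n ≠ 0) (he : Even n)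
    (huv : u ≠ v) :
    NextAdj G (markedDetour G s t) s t n u v ↔ (solution G s t).Adj u v := by
  have hst : s ≠ t := by
    rintro rfl
    simp at hD
  have hGst := not_adj_of_dist hD
  rw [nextAdj_of_forall_edist_le
    (fun x y => (markedDetour_edist_le hc hD x y).trans (by norm_num [sight])),
    alternatingInteraction_adj_even hD he huv, wants_markedDetour hc hD hn he,
    wants_markedDetour hc hD hn he, adj_comm (shortestPathGraph G s t) v u, solution_adj hst]
  by_cases h : G.Adj u v ∧ (u = t ∨ v = t)
  · have hu : u ≠ s := by
      rintro rfl
      rcases h with ⟨h, rfl | rfl⟩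
      · exact hst rfl
      · exact hGst h
    have hv : v ≠ s := by
      rintro rfl
      rcases h with ⟨h, rfl | rfl⟩
      · exact hGst h.symm
      · exact hst rfl
    rw [markedDetour_adj hu hv]
    simp [h, hu, hv]
  · simp only [h, not_false_eq_true, true_and, not_true, false_and, or_false]
    tauto

end Detour

end LargeDistance

/-! ### Distance more than 6: the sequence of phases and convergence. -/

section LargeDistance

variable {V : Type u} {G H : SimpleGraph V} {s t : V} {n : ℕ} {α β : ℝ}

/-- The graph `H` at time `n` belongs to the phase in which the neighbourhood of the target
grows. -/
def IsGrowing (G : SimpleGraph V) (s t : V) (n : ℕ) (H : SimpleGraph V) : Prop :=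
  ExtendsAt G H t ∧ ¬ H.Adj s t ∧ (n = 0 → H = G)

/-- The possible graphs at time `n`, for source and target at distance more than `6`. -/
def IsPhase (G : SimpleGraph V) (s t : V) (n : ℕ) (H : SimpleGraph V) : Prop :=
  IsGrowing G s t n H ∨ (Even n ∧ n ≠ 0 ∧ ExtendsAt G H t ∧ IsHub H s t) ∨
    (¬ Even n ∧ H = detour G s t) ∨ (Even n ∧ n ≠ 0 ∧ H = markedDetour G s t) ∨
    (n ≠ 0 ∧ H = solution G s t)

theorem ne_of_lt_dist {k : ℕ} (hD : k < G.dist s t) : s ≠ t := by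
  rintro rfl
  simp at hD

theorem exists_not_adj_target (hc : G.Connected) (hD : 6 < G.dist s t) :
    ∃ x, x ≠ s ∧ x ≠ t ∧ ¬ G.Adj t x := by
  obtain ⟨x, _, _, hx, -, -, hx', -⟩ := exists_initial_path hc hD
  refine ⟨x, hx.ne', ?_, fun h => ?_⟩
  · rintro rfl
    rw [dist_self] at hx'
    omega
  · have := dist_eq_one_iff_adj.2 h.symm
    omega

theorem IsGrowing.ne_zero (hc : G.Connected) (hD : 6 < G.dist s t) (h : IsGrowing G s t n H)
    (hh : IsHub H s t) : n ≠ 0 := by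
  rintro rfl
  obtain ⟨x, hxs, hxt, hx⟩ := exists_not_adj_target hc hD
  rw [h.2.2 rfl] at hh
  exact hx (hh x hxs hxt)

theorem isGrowing_zero (hD : 6 < G.dist s t) : IsGrowing G s t 0 G :=
  ⟨⟨le_rfl, fun _ _ _ _ h => h⟩, not_adj_of_dist hD, fun _ => rfl⟩

theorem IsGrowing.succ (hα : 0 < α) (hαβ : α < β) (hc : G.Connected) (hD : 6 < G.dist s t)
    (h : IsGrowing G s t n ((sssdSystem α β).run G s t n))
    (hh : ¬ IsHub ((sssdSystem α β).run G s t n) s t) :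
    IsGrowing G s t (n + 1) ((sssdSystem α β).run G s t (n + 1)) ∧
      (sssdSystem α β).run G s t n < (sssdSystem α β).run G s t (n + 1) ∧
      ∀ u v, ((sssdSystem α β).run G s t (n + 1)).Adj u v →
        ((sssdSystem α β).run G s t n).edist u v ≤ (15 : ℕ) := by
  have := growing_step hc h.1 h.2.1 (ne_of_lt_dist hD) hh
    (K := (sssdSystem α β).run G s t (n + 1)) fun u v huv => by
      rw [run_succ_adj hα hαβ G s t n huv, nextAdj_of_not_isHub hc hD h.1 h.2.1 h.2.2 hh huv]
  exact ⟨⟨this.2.1, this.2.2.1, fun h => absurd h n.succ_ne_zero⟩, this.1, this.2.2.2⟩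

theorem run_succ_of_isHub_even (hα : 0 < α) (hαβ : α < β) (hc : G.Connected)
    (hD : 6 < G.dist s t) (hH : ExtendsAt G ((sssdSystem α β).run G s t n) t)
    (hh : IsHub ((sssdSystem α β).run G s t n) s t) (hn : n ≠ 0) (he : Even n) :
    (sssdSystem α β).run G s t (n + 1) = detour G s t :=
  run_succ_eq hα hαβ fun _ _ huv => nextAdj_of_isHub_even hc hD hH hh hn he huv

theorem run_succ_of_isHub_odd (hα : 0 < α) (hαβ : α < β) (hc : G.Connected)
    (hD : 6 < G.dist s t) (hH : ExtendsAt G ((sssdSystem α β).run G s t n) t)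
    (hh : IsHub ((sssdSystem α β).run G s t n) s t) (hn : n ≠ 0) (he : ¬ Even n) :
    ExtendsAt G ((sssdSystem α β).run G s t (n + 1)) t ∧
      IsHub ((sssdSystem α β).run G s t (n + 1)) s t ∧
      ((sssdSystem α β).run G s t (n + 1)).Adj s t := by
  have key : ∀ u v, u ≠ v → _ := fun u v huv =>
    (run_succ_adj hα hαβ G s t n huv).trans (nextAdj_of_isHub_odd hc hD hH hh hn he huv)
  have hle : (sssdSystem α β).run G s t n ≤ (sssdSystem α β).run G s t (n + 1) :=
    fun u v h => (key u v h.ne).2 (Or.inl h)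
  refine ⟨⟨hH.1.trans hle, fun u v hu hv h => ?_⟩, fun x hxs hxt => hle (hh x hxs hxt),
    (key s t (ne_of_lt_dist hD)).2 (Or.inr (Or.inl ⟨rfl, rfl⟩))⟩
  rcases (key u v h.ne).1 h with h | h | h
  · exact hH.2 u v hu hv h
  · exact absurd h.2 hv
  · exact absurd h.2 hu

theorem run_succ_of_detour (hα : 0 < α) (hαβ : α < β) (hc : G.Connected)
    (hD : 6 < G.dist s t) (he : ¬ Even n)
    (h : (sssdSystem α β).run G s t n = detour G s t) :
    (sssdSystem α β).run G s t (n + 1) = markedDetour G s t :=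
  run_succ_eq hα hαβ fun _ _ huv => by rw [h, nextAdj_detour hc hD he huv]

theorem run_succ_of_markedDetour (hα : 0 < α) (hαβ : α < β) (hc : G.Connected)
    (hD : 6 < G.dist s t) (hn : n ≠ 0) (he : Even n)
    (h : (sssdSystem α β).run G s t n = markedDetour G s t) :
    (sssdSystem α β).run G s t (n + 1) = solution G s t :=
  run_succ_eq hα hαβ fun _ _ huv => by rw [h, nextAdj_markedDetour hc hD hn he huv]

theorem isPhase_step (hα : 0 < α) (hαβ : α < β) (hc : G.Connected) (hD : 6 < G.dist s t)
    (h : IsPhase G s t n ((sssdSystem α β).run G s t n)) :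
    IsPhase G s t (n + 1) ((sssdSystem α β).run G s t (n + 1)) ∧
      (∀ u v, ((sssdSystem α β).run G s t (n + 1)).Adj u v →
        ((sssdSystem α β).run G s t n).edist u v ≤ (15 : ℕ)) ∧
      ((sssdSystem α β).run G s t n = (sssdSystem α β).run G s t (n + 1) →
        (sssdSystem α β).run G s t n = solution G s t) := by
  have hst := ne_of_lt_dist hD
  -- A growing graph may also be a hub at an even time; splitting this case off first resolves the
  -- overlap of the phases.
  by_cases hhub : Even n ∧ n ≠ 0 ∧ ExtendsAt G ((sssdSystem α β).run G s t n) t ∧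
      IsHub ((sssdSystem α β).run G s t n) s t
  · obtain ⟨he, hn, hH, hh⟩ := hhub
    have key := run_succ_of_isHub_even hα hαβ hc hD hH hh hn he
    refine ⟨Or.inr (Or.inr (Or.inl ⟨Nat.even_add_one.not.2 (not_not.2 he), key⟩)),
      fun u v _ => (edist_le_of_isHub hc hD hH hh u v).trans (by norm_num), fun e => ?_⟩
    obtain ⟨x, hxs, hxt, hx⟩ := exists_not_adj_target hc hD
    rw [e, key] at hh
    exact absurd ((detour_adj hst.symm hxs).1 (hh x hxs hxt)) hx
  rcases h with h | h | ⟨he, h⟩ | ⟨he, hn, h⟩ | ⟨hn, h⟩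
  · by_cases hh : IsHub ((sssdSystem α β).run G s t n) s t
    · have hn := h.ne_zero hc hD hh
      have he : ¬ Even n := fun he => hhub ⟨he, hn, h.1, hh⟩
      have key := run_succ_of_isHub_odd hα hαβ hc hD h.1 hh hn he
      refine ⟨Or.inr (Or.inl ⟨Nat.even_add_one.2 he, n.succ_ne_zero, key.1, key.2.1⟩),
        fun u v _ => (edist_le_of_isHub hc hD h.1 hh u v).trans (by norm_num), fun e => ?_⟩
      exact absurd (e ▸ key.2.2) h.2.1
    · have key := h.succ hα hαβ hc hD hh
      exact ⟨Or.inl key.1, key.2.2, fun e => absurd e key.2.1.ne⟩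
  · exact absurd h hhub
  · have key := run_succ_of_detour hα hαβ hc hD he h
    refine ⟨Or.inr (Or.inr (Or.inr (Or.inl ⟨Nat.even_add_one.2 he, n.succ_ne_zero, key⟩))),
      fun u v _ => ?_, fun e => ?_⟩
    · rw [h]
      exact (detour_edist_le hc hD u v).trans (by norm_num)
    · rw [h, key] at e
      refine absurd ?_ (not_detour_adj (G := G) hst)
      rw [e]
      exact ⟨hst, Or.inr (Or.inl ⟨rfl, rfl⟩)⟩
  · have key := run_succ_of_markedDetour hα hαβ hc hD hn he h
    refine ⟨Or.inr (Or.inr (Or.inr (Or.inr ⟨n.succ_ne_zero, key⟩))), fun u v _ => ?_,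
      fun e => e.trans key⟩
    rw [h]
    exact (markedDetour_edist_le hc hD u v).trans (by norm_num)
  · have key := run_solution_of_isSettled hα hαβ hc hst (by omega) hn h
    refine ⟨Or.inr (Or.inr (Or.inr (Or.inr ⟨n.succ_ne_zero, key⟩))), fun u v huv => ?_,
      fun _ => h⟩
    rw [key, ← h] at huv
    exact huv.edist_le_one.trans (by norm_num)

theorem isPhase_run (hα : 0 < α) (hαβ : α < β) (hc : G.Connected) (hD : 6 < G.dist s t) (n : ℕ) :
    IsPhase G s t n ((sssdSystem α β).run G s t n) := by
  induction n with
  | zero => exact Or.inl (isGrowing_zero hD)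
  | succ n ih => exact (isPhase_step hα hαβ hc hD ih).1

theorem convergesTo_of_lt_dist [Finite V] (hα : 0 < α) (hαβ : α < β) (hc : G.Connected)
    (hD : 6 < G.dist s t) : (sssdSystem α β).ConvergesTo G s t (solution G s t) := by
  refine ⟨?_, fun n => (isPhase_step hα hαβ hc hD (isPhase_run hα hαβ hc hD n)).2.2⟩
  obtain ⟨n, h, hh⟩ := exists_of_forall_lt_or ((sssdSystem α β).run G s t)
    (fun n => IsGrowing G s t n ((sssdSystem α β).run G s t n))
    (fun n => IsHub ((sssdSystem α β).run G s t n) s t) (isGrowing_zero hD)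
    (fun n h hh => ⟨(h.succ hα hαβ hc hD hh).1, (h.succ hα hαβ hc hD hh).2.1⟩)
  have hn := h.ne_zero hc hD hh
  -- From a hub at an even time `m` the solution is reached at `m + 3`.
  have even : ∀ m, m ≠ 0 → Even m → ExtendsAt G ((sssdSystem α β).run G s t m) t →
      IsHub ((sssdSystem α β).run G s t m) s t →
      ∃ T, ∀ n, T ≤ n → (sssdSystem α β).run G s t n = solution G s t := by
    intro m hm he hH hh
    have h1 := run_succ_of_isHub_even hα hαβ hc hD hH hh hm he
    have he1 : ¬ Even (m + 1) := Nat.even_add_one.not.2 (not_not.2 he)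
    have h2 := run_succ_of_detour hα hαβ hc hD he1 h1
    have h3 := run_succ_of_markedDetour hα hαβ hc hD (m + 1).succ_ne_zero
      (Nat.even_add_one.2 he1) h2
    exact ⟨_, run_eq_of_le (fun k hk h => run_solution_of_isSettled hα hαβ hc (ne_of_lt_dist hD)
      (by omega) (by omega) h) h3⟩
  by_cases he : Even n
  · exact even n hn he h.1 hh
  · have key := run_succ_of_isHub_odd hα hαβ hc hD h.1 hh hn he
    exact even (n + 1) n.succ_ne_zero (Nat.even_add_one.2 he) key.1 key.2.1

theorem connectsWithin_of_lt_dist (hα : 0 < α) (hαβ : α < β) (hc : G.Connected)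
    (hD : 6 < G.dist s t) : (sssdSystem α β).ConnectsWithin 15 G s t :=
  fun n => (isPhase_step hα hαβ hc hD (isPhase_run hα hαβ hc hD n)).2.1

end LargeDistance

/-! ### The main theorem. -/

theorem mainTheorem9 (α β : ℝ) (hα : 0 < α) (hαβ : α < β) :
    ∃ N : NetworkSystem.{u},
      N.lower = α ∧ N.upper = β ∧
      (∀ (V : Type u) (G : SimpleGraph V) (s t : V) (n : ℕ),
        N.interaction G s t n = alternatingInteraction G s t n) ∧
      N.HasLocalEnergy ∧
      N.HasAlternatingEnergy ∧
      (∀ (V : Type u) [Finite V] (G : SimpleGraph V) (s t : V), G.Connected → s ≠ t →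
        N.ConnectsWithin 15 G s t) ∧
      N.SolvesSSSD := by
  refine ⟨sssdSystem α β, rfl, rfl, fun _ _ _ _ _ => rfl, sssdSystem_hasLocalEnergy α β,
    sssdSystem_hasAlternatingEnergy α β, fun V _ G s t hc hst => ?_, fun V _ G s t hc hst => ?_⟩
  · rcases le_or_gt (G.dist s t) 6 with hD | hD
    · exact connectsWithin_of_dist_le hα hαβ hc hst hD
    · exact connectsWithin_of_lt_dist hα hαβ hc hD
  · rcases le_or_gt (G.dist s t) 6 with hD | hD
    · exact convergesTo_of_dist_le hα hαβ hc hst hD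
    · exact convergesTo_of_lt_dist hα hαβ hc hD
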